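/- Theorem. A weight is a non-negative Lebesgue measurable function on $(0,\infty)$, possibly taking the value $\infty$. For a function $f$ on a $\sigma$-finite measure space $(X,\mu)$ let $f^*(t)=\inf\{\lambda>0:\mu\{|f|>\lambda\}\le t\}$ and $f^{**}(t)=\frac1t\int_0^tf^*$ for $t>0$, and for $0<r<\infty$ and a weight $w$ put $\|h\|_{r,w}=\big(\int_0^\infty|h(t)|^rw(t)\,dt\big)^{1/r}$ and $$\|f\|_{\Lambda_r(w)}=\|f^*\|_{r,w},\qquad \|f\|_{\Gamma_r(w)}=\|f^{**}\|_{r,w},\qquad \|f\|_{\Theta_r(w)}=\sup\{\|h^*\|_{r,w}: h^{**}\le f^{**}\},$$ where $h$ ranges over the measurable functions on $(0,\infty)$ with Lebesgue measure. Let $\mathcal T$ be the collection of all operators $T$ defined on (complex) $L^1_\mu$, for some probability measure $\mu$, with values in the $\nu$-measurable functions, for some $\sigma$-finite measure $\nu$, which are sublinear, i.e. $|T(f+g)|\le|Tf|+|Tg|$ and $|T(cf)|=|c||Tf|$ almost everywhere, and which are of type $(1,\infty)$ and $(2,2)$, i.e. bounded from $L^1_\mu$ to $L^\infty_\nu$ and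 from $L^2_\mu$ to $L^2_\nu$. Let $0<p\le2\le q<\infty$ and let $u,w$ be weights. Put $v(t)=t^{p-2}w(1/t)$, $\omega_z(t)=\min(t^{-2},z^{-2})$ for $t>0$, and $$C_\omega=\sup_{z>1}\frac{\|\omega_z\|_{\Theta_{q/2}(u)}}{\|\omega_z\|_{p/2,v}}$$ (with $0/0=0$, $a/0=\infty$ for $a>0$, and $a/\infty=0$ for all $a\in[0,\infty]$). The following are equivalent. 1. For each $T\in\mathcal T$ there is a finite constant $C$ such that $\|Tf\|_{\Gamma_q(u)}\le C\|f\|_{\Gamma_p(w)}$ for all $f\in L^1_\mu$, where $\mu$ is the probability measure associated with $T$. 2. There is a finite constant $C$ such that $\|\hat f\|_{\Gamma_q(u)}\le C\|f\|_{\Gamma_p(w)}$ for all $f\in L^1(\mathbb T)$. 3. There is a finite constant $C$ such that $\|\hat f\|_{\Lambda_q(u)}\le C\|f\|_{\Gamma_p(w)}$ for all $f\in L^1(\mathbb T)$. 4. $C_\omega<\infty$. Here $\mathbb T=\mathbb R/\mathbb Z$ carries normalized Lebesgue measure, and $\hat f(n)=\int_0^1e^{-2\pi inx}f(x)\,dx$,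 $n\in\mathbb Z$, is regarded as a function on $\mathbb Z$ with counting measure. When $q=2$, these are also equivalent to $C_{xy}<\infty$, where (with $0\cdot\infty=0$) $$C_{xy}=\sup_{1<1/x<y}\Big(\frac1{xy}\int_0^yu(t)\,dt\Big)^{1/2}\Big(x^{-p}\int_0^xw(t)\,dt+\int_x^\infty w(t)\,\frac{dt}{t^p}\Big)^{-1/p}.$$ -/

import Mathlib

open MeasureTheory Set
open scoped ENNReal NNReal

noncomputable section

namespace LorentzFourier

/-- The non-increasing rearrangement of `f` with respect to `μ`,
`f*(t) = inf {l > 0 : μ {|f| > l} ≤ t}`, as a function of `t > 0` with values in `[0, ∞]`. -/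
def rearr {X E : Type*} [MeasurableSpace X] [NormedAddCommGroup E] (μ : Measure X) (f : X → E)
    (t : ℝ) : ℝ≥0∞ :=
  sInf {l : ℝ≥0∞ | 0 < l ∧ μ {x | l < ‖f x‖ₑ} ≤ ENNReal.ofReal t}

/-- The averaged rearrangement `f**(t) = (1/t) ∫_0^t f*(s) ds`, for `t > 0`. -/
def rearrAvg {X E : Type*} [MeasurableSpace X] [NormedAddCommGroup E] (μ : Measure X) (f : X → E)
    (t : ℝ) : ℝ≥0∞ :=
  (ENNReal.ofReal t)⁻¹ * ∫⁻ s in Ioo 0 t, rearr μ f s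

/-- Lebesgue measure on the half-line `(0, ∞)`. -/
def halfLine : Measure ℝ := volume.restrict (Ioi 0)

/-- `‖h‖_{p,w} = (∫_0^∞ h(t)^p w(t) dt)^{1/p}` for non-negative `h`, possibly infinite. Only the
values of `h` and `w` on `(0, ∞)` matter. -/
def weightedNorm (p : ℝ) (w h : ℝ → ℝ≥0∞) : ℝ≥0∞ :=
  (∫⁻ t, h t ^ p * w t ∂halfLine) ^ (1 / p)

/-- `‖f‖_{Λ_p(w)} = ‖f*‖_{p,w}`. -/
def lambdaNorm {X E : Type*} [MeasurableSpace X] [NormedAddCommGroup E] (p : ℝ) (w : ℝ → ℝ≥0∞)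
    (μ : Measure X) (f : X → E) : ℝ≥0∞ :=
  weightedNorm p w (rearr μ f)

/-- `‖f‖_{Γ_p(w)} = ‖f**‖_{p,w}`. -/
def gammaNorm {X E : Type*} [MeasurableSpace X] [NormedAddCommGroup E] (p : ℝ) (w : ℝ → ℝ≥0∞)
    (μ : Measure X) (f : X → E) : ℝ≥0∞ :=
  weightedNorm p w (rearrAvg μ f)

/-- `‖f‖_{Θ_p(w)} = sup ‖h*‖_{p,w}`, the supremum over all Lebesgue measurable functions `h` on
`(0, ∞)` such that `h** ≤ f**` on `(0, ∞)`. -/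
def thetaNorm {X E : Type*} [MeasurableSpace X] [NormedAddCommGroup E] (p : ℝ) (w : ℝ → ℝ≥0∞)
    (μ : Measure X) (f : X → E) : ℝ≥0∞ :=
  ⨆ (h : ℝ → ℝ) (_ : AEMeasurable h halfLine)
    (_ : ∀ t, 0 < t → rearrAvg halfLine h t ≤ rearrAvg μ f t),
    weightedNorm p w (rearr halfLine h)

/-- `ω_z(t) = min (t⁻²) (z⁻²)` for `t > 0`. -/
def omega (z t : ℝ) : ℝ := min ((t ^ 2)⁻¹) ((z ^ 2)⁻¹)

/-- The dual weight `v(t) = t^{p-2} w(1/t)` for `t > 0`. -/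
def dualWeight (p : ℝ) (w : ℝ → ℝ≥0∞) (t : ℝ) : ℝ≥0∞ :=
  ENNReal.ofReal (t ^ (p - 2)) * w (1 / t)

/-- `C_ω = sup_{z > 1} ‖ω_z‖_{Θ_{q/2}(u)} / ‖ω_z‖_{p/2,v}` with `v(t) = t^{p-2} w(1/t)`. Here, as
always in `[0, ∞]`, `0 / 0 = 0`, `a / 0 = ∞` for `a > 0`, and `a / ∞ = 0` for all `a`. -/
def COmega (p q : ℝ) (u w : ℝ → ℝ≥0∞) : ℝ≥0∞ :=
  ⨆ (z : ℝ) (_ : 1 < z),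
    thetaNorm (q / 2) u halfLine (omega z) /
      weightedNorm (p / 2) (dualWeight p w) (fun t => ENNReal.ofReal (omega z t))

/-- `C_xy`, the supremum over `1 < 1/x < y` of
`((1/(xy)) ∫_0^y u)^{1/2} (x^{-p} ∫_0^x w + ∫_x^∞ w(t) t^{-p} dt)^{-1/p}`, with `0 * ∞ = 0`. -/
def Cxy (p : ℝ) (u w : ℝ → ℝ≥0∞) : ℝ≥0∞ :=
  ⨆ (x : ℝ) (y : ℝ) (_ : 0 < x) (_ : 1 < 1 / x) (_ : 1 / x < y),
    (ENNReal.ofReal (1 / (x * y)) * ∫⁻ t in Ioo 0 y, u t) ^ (1 / 2 : ℝ) *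
      (ENNReal.ofReal (x ^ (-p)) * (∫⁻ t in Ioo 0 x, w t) +
        ∫⁻ t in Ioi x, w t * ENNReal.ofReal (t ^ (-p))) ^ (-(1 / p))

/-- `T` is a sublinear operator of type `(1, ∞)` and `(2, 2)`. It is meant for a probability
measure `μ`; then `L¹ + L² = L¹` is the domain, and the range lies in `L^∞ ⊆ L² + L^∞` by
`bound_one`. Sublinear means `|T(f + g)| ≤ |Tf| + |Tg|` and `|T(cf)| = |c| |Tf|` a.e. -/
structure IsSublinearOfType {X Y : Type*} [MeasurableSpace X] [MeasurableSpace Y]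
    (μ : Measure X) (ν : Measure Y) (T : Lp ℂ 1 μ → (Y →ₘ[ν] ℂ)) : Prop where
  add_le : ∀ f g : Lp ℂ 1 μ, ∀ᵐ y ∂ν, ‖T (f + g) y‖ ≤ ‖T f y‖ + ‖T g y‖
  smul_eq : ∀ (c : ℂ) (f : Lp ℂ 1 μ), ∀ᵐ y ∂ν, ‖T (c • f) y‖ = ‖c‖ * ‖T f y‖
  bound_one : ∃ M : ℝ≥0, ∀ f : Lp ℂ 1 μ, eLpNorm (T f) ∞ ν ≤ M * eLpNorm f 1 μ
  bound_two : ∃ M : ℝ≥0, ∀ f : Lp ℂ 1 μ, MemLp f 2 μ →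
    eLpNorm (T f) 2 ν ≤ M * eLpNorm f 2 μ

end LorentzFourier

end

/-!
# Fourier inequalities between Lorentz Gamma spaces

Put `θ(s) = sup_{a > 0} min(s, 1/a) (∫_0^a u)^{2/q}` (`hull (q / 2) u`) and let
`κ(x) = ‖min(1, x/·)‖_{p,w}` (`cutoffNorm p w`), the `Γ_p(w)` norm of the characteristic function of
a set of measure `x`. The supremum in `‖ω_{1/x}‖_{Θ_{q/2}(u)}` is attained up to the factor `3` on
multiples of characteristic functions of intervals, so it is comparable to `x θ(x)`
(`hull_le_thetaNorm`, `thetaNorm_le_hull`), and the denominator in `C_ω` is `κ(x)²`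
(`weightedNorm_omega`). Hence `C_ω < ∞` says that `x θ(x) ≤ D κ(x)²` for all `0 < x < 1`.

*Sufficiency* (`IsSublinearOfType.exists_gammaNorm_le`). Cutting `f` at height `f*(1/x)` gives the
Jodeit–Torchinsky estimate `∫_0^x (Tf)*² ≤ K ∫_0^x (∫_0^{1/t} f*)² dt`, in which Hardy's inequality
allows `(Tf)**` in place of `(Tf)*`. So `(Tf)**²` is majorized, in the sense of Hardy, Littlewood and
Pólya, by `t ↦ ρ(0, 1/t)`, where `ρ` is the measure with `ρ(0, s) = 16 K (∫_0^s f*)²`. For every such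
`ρ`, a non-increasing function majorized by `t ↦ ρ(0, 1/t)` has `(q/2, u)`-norm at most
`2 ∫ θ(s)/s dρ(s)` (`weightedNorm_le_of_majorized`). Here `dρ = 32 K s γ(s) ds` with the
non-increasing function `γ = f* f**` (`sqSlope`). Let `x(λ)` be the length of the interval
`{γ > λ}`; it is at most `1`, because the measure space of `f` has measure `1`. Layer by layer,
`∫ θ γ ≤ ∫ x(λ) θ(x(λ)) dλ`, which the hypothesis bounds by `D ∫ κ(x(λ))² dλ`. Finally
`∫ min(1, x(λ)/s)² dλ = f**(s)²`, and since `p/2 ≤ 1` the reverse Minkowski inequality gives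
`∫ κ(x(λ))² dλ ≤ ‖f**‖²_{p,w}` (`lintegral_cutoffNorm_sq_le`).

*Necessity* (`hull_le_of_fourier_bound`). Let `f` equal `e(j²/N)` on `[j/N, (j + x)/N)`,
`0 ≤ j < N`, and zero elsewhere (`circleChirp`). Its support has measure `x`, and as quadratic Gauss
sums have modulus `√N`, all Fourier coefficients `f̂(n)` with `|n| x ≤ N/6` have modulus at least
`x/(2√N)`. The choice `N ≈ x y` with `y = max(a, 1/x)` makes the inequality for `f` bound the term
of `θ(x)` that belongs to `a`.

The remaining implications are `f* ≤ f**` and the fact that `f ↦ f̂` is an admissible operator. For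
`q = 2` no root is taken in `θ`, so the terms of `x θ(x)/κ(x)²` with `a > 1/x` are exactly the
squares of the quotients in `C_xy`, and the other terms are at most that with `a = 1/x`
(`COmega_two_lt_top_iff`).
-/

open MeasureTheory Set
open scoped ENNReal NNReal

noncomputable section

namespace LorentzFourier

/-! ### Integral inequalities for functions with values in `[0, ∞]` -/

/-- Minkowski's integral inequality with respect to a finite measure `μ`, which makes the integrals of
the truncations `min (A a) n` finite, so that they can be cancelled. -/
theorem lintegral_minkowski_of_isFiniteMeasure {α β : Type*} [MeasurableSpace α]
    [MeasurableSpace β] {μ : Measure α} {ν : Measure β} [IsFiniteMeasure μ] [SFinite ν]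
    {K : α → β → ℝ≥0∞} (hK : Measurable (Function.uncurry K)) {P : ℝ} (hP : 1 ≤ P) :
    ∫⁻ a, (∫⁻ b, K a b ∂ν) ^ P ∂μ ≤ (∫⁻ b, (∫⁻ a, K a b ^ P ∂μ) ^ (1 / P) ∂ν) ^ P := by
  have hP0 : 0 < P := by linarith
  rcases eq_or_lt_of_le hP with rfl | hP1
  · simp only [ENNReal.rpow_one, div_one]
    rw [lintegral_lintegral_swap hK.aemeasurable]
  set A : α → ℝ≥0∞ := fun a => ∫⁻ b, K a b ∂ν
  set R := ∫⁻ b, (∫⁻ a, K a b ^ P ∂μ) ^ (1 / P) ∂ν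
  have hAm : Measurable A := hK.lintegral_prod_right'
  have hpq : P.HolderConjugate (P / (P - 1)) := Real.HolderConjugate.conjExponent hP1
  have key : ∀ n : ℕ, ∫⁻ a, (min (A a) n) ^ P ∂μ ≤ R ^ P := by
    intro n
    set I := ∫⁻ a, (min (A a) n) ^ P ∂μ
    have hAn : Measurable fun a => min (A a) (n : ℝ≥0∞) := hAm.min measurable_const
    have hIfin : I ≠ ∞ := by
      refine ne_top_of_le_ne_top ?_ (lintegral_mono (g := fun _ => (n : ℝ≥0∞) ^ P)
        fun a => ENNReal.rpow_le_rpow (min_le_right _ _) hP0.le)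
      rw [lintegral_const]
      exact ENNReal.mul_ne_top (ENNReal.rpow_ne_top_of_nonneg hP0.le (by simp)) (by simp)
    have h1 : I ≤ R * I ^ (1 / (P / (P - 1))) := by
      calc I ≤ ∫⁻ a, A a * (min (A a) n) ^ (P - 1) ∂μ := by
            refine lintegral_mono fun a => ?_
            calc (min (A a) (n : ℝ≥0∞)) ^ P
                = (min (A a) n) * (min (A a) n) ^ (P - 1) := by
                  nth_rw 2 [← ENNReal.rpow_one (min (A a) (n : ℝ≥0∞))]
                  rw [← ENNReal.rpow_add_of_nonneg _ _ zero_le_one (by linarith)]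
                  congr 1; ring
              _ ≤ _ := by gcongr; exact min_le_left _ _
        _ = ∫⁻ a, ∫⁻ b, K a b * (min (A a) n) ^ (P - 1) ∂ν ∂μ := by
            refine lintegral_congr fun a => ?_
            rw [lintegral_mul_const]
            exact hK.of_uncurry_left
        _ = ∫⁻ b, ∫⁻ a, K a b * (min (A a) n) ^ (P - 1) ∂μ ∂ν := by
            rw [lintegral_lintegral_swap]
            exact (hK.mul ((hAn.comp measurable_fst).pow_const _)).aemeasurable
        _ ≤ ∫⁻ b, (∫⁻ a, K a b ^ P ∂μ) ^ (1 / P) * I ^ (1 / (P / (P - 1))) ∂ν := by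
            refine lintegral_mono fun b => ?_
            refine (ENNReal.lintegral_mul_le_Lp_mul_Lq μ hpq
              (hK.of_uncurry_right).aemeasurable (hAn.pow_const _).aemeasurable).trans_eq ?_
            congr 2
            refine lintegral_congr fun a => ?_
            rw [← ENNReal.rpow_mul]
            congr 1
            field_simp [(by linarith : P - 1 ≠ 0)]
        _ = R * I ^ (1 / (P / (P - 1))) := by
            rw [lintegral_mul_const]
            exact ((hK.pow_const P).comp measurable_swap).lintegral_prod_right'.pow_const _
    rcases eq_or_ne I 0 with h0 | h0
    · rw [h0]; exact zero_le
    have h2 : I = I ^ (1 / P) * I ^ (1 / (P / (P - 1))) := by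
      rw [← ENNReal.rpow_add _ _ h0 hIfin]
      have : 1 / P + 1 / (P / (P - 1)) = 1 := by
        have : P - 1 ≠ 0 := by linarith
        field_simp; ring
      rw [this, ENNReal.rpow_one]
    have h3 : I ^ (1 / P) ≤ R := by
      nth_rw 1 [h2] at h1
      refine (ENNReal.mul_le_mul_iff_left ?_ ?_).1 h1
      · simp [h0, hIfin]
      · refine ENNReal.rpow_ne_top_of_nonneg ?_ hIfin
        have : 0 < P - 1 := by linarith
        positivity
    calc I = (I ^ (1 / P)) ^ P := by
          rw [← ENNReal.rpow_mul, one_div_mul_cancel hP0.ne', ENNReal.rpow_one]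
      _ ≤ R ^ P := ENNReal.rpow_le_rpow h3 hP0.le
  have hsup : ∀ a, A a ^ P = ⨆ n : ℕ, (min (A a) (n : ℝ≥0∞)) ^ P := by
    intro a
    refine le_antisymm ?_ (iSup_le fun n => ENNReal.rpow_le_rpow (min_le_left _ _) hP0.le)
    rw [← ENNReal.rpow_le_rpow_iff (z := P⁻¹) (by positivity), ENNReal.rpow_rpow_inv hP0.ne']
    refine le_of_forall_lt fun c hc => ?_
    obtain ⟨n, hn⟩ := ENNReal.exists_nat_gt hc.ne_top
    refine (lt_min hc hn).trans_le ?_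
    rw [ENNReal.le_rpow_inv_iff hP0]
    exact le_iSup (fun n : ℕ => (min (A a) (n : ℝ≥0∞)) ^ P) n
  calc ∫⁻ a, A a ^ P ∂μ = ∫⁻ a, ⨆ n : ℕ, (min (A a) (n : ℝ≥0∞)) ^ P ∂μ := by simp_rw [hsup]
    _ = ⨆ n : ℕ, ∫⁻ a, (min (A a) (n : ℝ≥0∞)) ^ P ∂μ := by
        refine lintegral_iSup (fun n => (hAm.min measurable_const).pow_const _) ?_
        intro m n hmn a
        exact ENNReal.rpow_le_rpow (min_le_min_left _ (by exact_mod_cast hmn)) hP0.le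
    _ ≤ R ^ P := iSup_le key

/-- **Minkowski's integral inequality**. -/
theorem lintegral_minkowski {α β : Type*} [MeasurableSpace α] [MeasurableSpace β]
    {μ : Measure α} {ν : Measure β} [SFinite μ] [SFinite ν]
    {K : α → β → ℝ≥0∞} (hK : Measurable (Function.uncurry K)) {P : ℝ} (hP : 1 ≤ P) :
    (∫⁻ a, (∫⁻ b, K a b ∂ν) ^ P ∂μ) ^ (1 / P) ≤ ∫⁻ b, (∫⁻ a, K a b ^ P ∂μ) ^ (1 / P) ∂ν := by
  have hP0 : 0 < P := by linarith
  rw [one_div, ENNReal.rpow_inv_le_iff hP0, ← one_div]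
  calc ∫⁻ a, (∫⁻ b, K a b ∂ν) ^ P ∂μ
      = ∑' i, ∫⁻ a, (∫⁻ b, K a b ∂ν) ^ P ∂(sfiniteSeq μ i) := by
        rw [← lintegral_sum_measure, sum_sfiniteSeq]
    _ ≤ _ := by
        rw [ENNReal.tsum_eq_iSup_sum]
        refine iSup_le fun s => ?_
        rw [← lintegral_finsetSum_measure]
        have hle : ∑ i ∈ s, sfiniteSeq μ i ≤ μ := by
          conv_rhs => rw [← sum_sfiniteSeq μ]
          rw [Measure.le_iff]
          intro t ht
          rw [Measure.sum_apply _ ht, Measure.finsetSum_apply]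
          exact ENNReal.sum_le_tsum s
        refine (lintegral_minkowski_of_isFiniteMeasure hK hP).trans ?_
        gcongr

/-- Every `a ∈ [0, ∞]` is the length of the interval `(0, a)`. This is what layer cake formulas and the
equimeasurability of `f` and `f*` rest on. -/
theorem halfLine_ofReal_lt (a : ℝ≥0∞) : halfLine {l : ℝ | ENNReal.ofReal l < a} = a := by
  have hm : MeasurableSet {l : ℝ | ENNReal.ofReal l < a} :=
    measurableSet_lt ENNReal.measurable_ofReal measurable_const
  rw [halfLine, Measure.restrict_apply hm]
  rcases eq_or_ne a ∞ with rfl | ha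
  · simp
  · have : {l : ℝ | ENNReal.ofReal l < a} ∩ Ioi 0 = Ioo 0 a.toReal := by
      ext l
      simp only [mem_inter_iff, mem_ofPred_eq, mem_Ioi, mem_Ioo]
      constructor
      · rintro ⟨h, h0⟩; exact ⟨h0, (ENNReal.ofReal_lt_iff_lt_toReal h0.le ha).1 h⟩
      · rintro ⟨h0, h⟩; exact ⟨(ENNReal.ofReal_lt_iff_lt_toReal h0.le ha).2 h, h0⟩
    rw [this, Real.volume_Ioo, sub_zero, ENNReal.ofReal_toReal ha]

theorem lintegral_indicator_lt (a : ℝ≥0∞) :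
    ∫⁻ l, ({l : ℝ | ENNReal.ofReal l < a}.indicator 1 l : ℝ≥0∞) ∂halfLine = a := by
  rw [lintegral_indicator_one (measurableSet_lt ENNReal.measurable_ofReal measurable_const),
    halfLine_ofReal_lt]

instance : SFinite halfLine := by unfold halfLine; infer_instance
instance : SigmaFinite halfLine := by unfold halfLine; infer_instance
instance : NullSingletonClass halfLine := by unfold halfLine; infer_instance

/-- **Layer cake formula**, for functions with values in `[0, ∞]`. -/
theorem lintegral_eq_lintegral_meas_ofReal_lt {α : Type*} [MeasurableSpace α] {μ : Measure α}
    [SFinite μ] {F : α → ℝ≥0∞} (hF : AEMeasurable F μ) :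
    ∫⁻ x, F x ∂μ = ∫⁻ l, μ {x | ENNReal.ofReal l < F x} ∂halfLine := by
  wlog hFm : Measurable F generalizing F
  · rw [lintegral_congr_ae hF.ae_eq_mk, this hF.measurable_mk.aemeasurable hF.measurable_mk]
    refine lintegral_congr fun l => measure_congr ?_
    filter_upwards [hF.ae_eq_mk] with x hx
    exact congrArg (fun a => ENNReal.ofReal l < a) hx.symm
  have hm : MeasurableSet {z : α × ℝ | ENNReal.ofReal z.2 < F z.1} :=
    measurableSet_lt (ENNReal.measurable_ofReal.comp measurable_snd) (hFm.comp measurable_fst)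
  calc ∫⁻ x, F x ∂μ
      = ∫⁻ x, ∫⁻ l, {z : α × ℝ | ENNReal.ofReal z.2 < F z.1}.indicator 1 (x, l) ∂halfLine ∂μ :=
        lintegral_congr fun x => (lintegral_indicator_lt (F x)).symm
    _ = ∫⁻ l, ∫⁻ x, {z : α × ℝ | ENNReal.ofReal z.2 < F z.1}.indicator 1 (x, l) ∂μ ∂halfLine :=
        lintegral_lintegral_swap (measurable_one.indicator hm).aemeasurable
    _ = _ := by
        refine lintegral_congr fun l => ?_
        rw [← lintegral_indicator_one (measurableSet_lt measurable_const hFm)]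
        rfl

/-- The layer cake formula applied to one factor: the integral of `F g` is the integral over `l > 0` of
the integrals of `F` over the superlevel sets `{g > l}`. -/
theorem lintegral_mul_eq_lintegral_superlevel {m : Measure ℝ} [SFinite m] {F g : ℝ → ℝ≥0∞}
    (hF : Measurable F) (hg : Measurable g) :
    ∫⁻ s, F s * g s ∂m = ∫⁻ l, ∫⁻ s in {s | ENNReal.ofReal l < g s}, F s ∂m ∂halfLine := by
  have hVm : MeasurableSet {z : ℝ × ℝ | ENNReal.ofReal z.2 < g z.1} :=
    measurableSet_lt (ENNReal.measurable_ofReal.comp measurable_snd) (hg.comp measurable_fst)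
  calc ∫⁻ s, F s * g s ∂m
      = ∫⁻ s, ∫⁻ l, F s * {z : ℝ × ℝ | ENNReal.ofReal z.2 < g z.1}.indicator 1 (s, l)
          ∂halfLine ∂m := by
        refine lintegral_congr fun s => ?_
        rw [lintegral_const_mul]
        · congr 1
          exact (lintegral_indicator_lt _).symm
        · exact (measurable_one.indicator hVm).comp measurable_prodMk_left
    _ = ∫⁻ l, ∫⁻ s, F s * {z : ℝ × ℝ | ENNReal.ofReal z.2 < g z.1}.indicator 1 (s, l)
          ∂m ∂halfLine :=
        lintegral_lintegral_swap ((hF.comp measurable_fst).mul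
          (measurable_one.indicator hVm)).aemeasurable
    _ = _ := by
        refine lintegral_congr fun l => ?_
        rw [← lintegral_indicator (measurableSet_lt measurable_const hg)]
        refine lintegral_congr fun s => ?_
        by_cases hs : ENNReal.ofReal l < g s <;> simp [hs]

/-! ### Rearrangements -/

section Rearrangement

variable {X E : Type*} [MeasurableSpace X] [NormedAddCommGroup E] {μ : Measure X}

/-- The Galois connection between the rearrangement and the distribution function. The infimum in
`rearr` is attained, by continuity from below of `μ` along the superlevel sets. -/
theorem lt_rearr_iff {f : X → E} {t : ℝ} {l : ℝ≥0∞} :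
    l < rearr μ f t ↔ ENNReal.ofReal t < μ {x | l < ‖f x‖ₑ} := by
  rw [← not_iff_not, not_lt, not_lt]
  constructor
  · intro h
    rcases eq_or_ne l ∞ with rfl | hl
    · simp
    obtain ⟨v, hv, hvl, hvt⟩ := exists_seq_strictAnti_tendsto' (lt_top_iff_ne_top.2 hl)
    have hU : {x | l < ‖f x‖ₑ} = ⋃ n, {x | v n < ‖f x‖ₑ} := by
      ext x
      simp only [mem_ofPred_eq, mem_iUnion]
      constructor
      · intro hx
        exact ((hvt.eventually (gt_mem_nhds hx)).exists)
      · rintro ⟨n, hn⟩; exact (hvl n).1.trans hn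
    rw [hU, Monotone.measure_iUnion]
    · refine iSup_le fun n => ?_
      obtain ⟨m, hm, hmn⟩ := sInf_lt_iff.1 (h.trans_lt (hvl n).1)
      exact (measure_mono fun x hx => hmn.trans hx).trans hm.2
    · intro m n hmn x hx
      exact (hv.antitone hmn).trans_lt hx
  · intro h
    refine le_of_forall_gt fun c hc => ?_
    obtain ⟨d, hd, hdc⟩ := exists_between hc
    exact lt_of_le_of_lt (sInf_le ⟨(zero_le).trans_lt hd,
      (measure_mono fun x hx => hd.trans hx).trans h⟩) hdc

theorem rearr_le_iff {f : X → E} {t : ℝ} {l : ℝ≥0∞} :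
    rearr μ f t ≤ l ↔ μ {x | l < ‖f x‖ₑ} ≤ ENNReal.ofReal t := by
  rw [← not_lt, lt_rearr_iff, not_lt]

theorem rearr_antitone (f : X → E) : Antitone (rearr μ f) := by
  intro s t hst
  rw [rearr_le_iff]
  exact (rearr_le_iff.1 le_rfl).trans (ENNReal.ofReal_le_ofReal hst)

theorem measurable_rearr (f : X → E) : Measurable (rearr μ f) := (rearr_antitone f).measurable

theorem rearr_le_add {F : Type*} [NormedAddCommGroup F] {f : X → E} {g : X → F} {a : ℝ≥0∞}
    (h : ∀ᵐ x ∂μ, ‖f x‖ₑ ≤ a + ‖g x‖ₑ) (t : ℝ) : rearr μ f t ≤ a + rearr μ g t := by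
  rw [rearr_le_iff]
  refine le_trans (measure_mono_ae ?_) (rearr_le_iff.1 (le_refl (rearr μ g t)))
  filter_upwards [h] with x hx hlt
  have hlt : a + rearr μ g t < ‖f x‖ₑ := hlt
  change rearr μ g t < ‖g x‖ₑ
  exact lt_of_add_lt_add_left (hlt.trans_le hx)

/-- A function and its rearrangement are equimeasurable. -/
theorem halfLine_lt_rearr (f : X → E) (l : ℝ≥0∞) :
    halfLine {t | l < rearr μ f t} = μ {x | l < ‖f x‖ₑ} := by
  simp_rw [lt_rearr_iff]
  exact halfLine_ofReal_lt _

/-- The function `|f|` and its rearrangement are equimeasurable, so they have the same integrals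
after composition with a function `φ` whose superlevel sets are open rays. -/
theorem lintegral_comp_rearr [SFinite μ] {f : X → E} (hf : AEStronglyMeasurable f μ)
    {φ : ℝ≥0∞ → ℝ≥0∞} (hφ : Measurable φ) (hray : ∀ l : ℝ≥0∞, ∃ c, ∀ a, l < φ a ↔ c < a) :
    ∫⁻ t, φ (rearr μ f t) ∂halfLine = ∫⁻ x, φ ‖f x‖ₑ ∂μ := by
  choose ψ hψ using hray
  rw [lintegral_eq_lintegral_meas_ofReal_lt (F := fun t => φ (rearr μ f t))
      (hφ.comp (measurable_rearr f)).aemeasurable,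
    lintegral_eq_lintegral_meas_ofReal_lt (F := fun x => φ ‖f x‖ₑ)
      (hφ.comp_aemeasurable hf.enorm)]
  refine lintegral_congr fun l => ?_
  simp_rw [hψ]
  exact halfLine_lt_rearr f _

theorem lintegral_rearr [SFinite μ] {f : X → E} (hf : AEStronglyMeasurable f μ) :
    ∫⁻ t, rearr μ f t ∂halfLine = ∫⁻ x, ‖f x‖ₑ ∂μ :=
  lintegral_comp_rearr hf measurable_id fun l => ⟨l, fun _ => Iff.rfl⟩

theorem lintegral_rearr_sq [SFinite μ] {f : X → E} (hf : AEStronglyMeasurable f μ) :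
    ∫⁻ t, rearr μ f t ^ 2 ∂halfLine = ∫⁻ x, ‖f x‖ₑ ^ 2 ∂μ := by
  refine lintegral_comp_rearr hf (φ := fun a => a ^ 2) (by fun_prop)
    fun l => ⟨l ^ (1 / 2 : ℝ), fun a => ?_⟩
  rw [one_div, ENNReal.rpow_inv_lt_iff (by norm_num)]
  simp

theorem lintegral_rearr_tsub [SFinite μ] {f : X → E} (hf : AEStronglyMeasurable f μ) (τ : ℝ≥0∞) :
    ∫⁻ t, (rearr μ f t - τ) ∂halfLine = ∫⁻ x, (‖f x‖ₑ - τ) ∂μ :=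
  lintegral_comp_rearr hf (φ := fun a => a - τ) (by fun_prop)
    fun l => ⟨l + τ, fun a => lt_tsub_iff_right⟩

theorem lintegral_min_rearr_sq [SFinite μ] {f : X → E} (hf : AEStronglyMeasurable f μ)
    (τ : ℝ≥0∞) :
    ∫⁻ t, min (rearr μ f t) τ ^ 2 ∂halfLine = ∫⁻ x, min ‖f x‖ₑ τ ^ 2 ∂μ := by
  refine lintegral_comp_rearr hf (φ := fun a => min a τ ^ 2) (by fun_prop) fun l => ?_
  have key : ∀ a : ℝ≥0∞, l < a ^ 2 ↔ l ^ (1 / 2 : ℝ) < a := fun a => by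
    rw [one_div, ENNReal.rpow_inv_lt_iff (by norm_num)]
    simp
  by_cases h : l ^ (1 / 2 : ℝ) < τ
  · exact ⟨l ^ (1 / 2 : ℝ), fun a => by rw [key, lt_min_iff, and_iff_left h]⟩
  · exact ⟨∞, fun a => by
      rw [key, lt_min_iff]; exact ⟨fun h' => absurd h'.2 h, fun h' => absurd h' not_top_lt⟩⟩

end Rearrangement

/-! ### Averages of non-increasing functions -/

theorem lintegral_Ioo_eq_halfLine (F : ℝ → ℝ≥0∞) (x : ℝ) :
    ∫⁻ s in Ioo 0 x, F s = ∫⁻ s in Iio x, F s ∂halfLine := by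
  rw [halfLine, Measure.restrict_restrict measurableSet_Iio, inter_comm, Ioi_inter_Iio]

theorem ae_halfLine {P : ℝ → Prop} (h : ∀ t, 0 < t → P t) : ∀ᵐ t ∂halfLine, P t :=
  (ae_restrict_iff' measurableSet_Ioi).2 (ae_of_all _ h)

/-- A non-increasing function is at most its average. -/
theorem ofReal_mul_le_lintegral {φ : ℝ → ℝ≥0∞} (hφ : AntitoneOn φ (Ioi 0)) {s : ℝ} (hs : 0 < s) :
    ENNReal.ofReal s * φ s ≤ ∫⁻ r in Ioo 0 s, φ r := by
  calc ENNReal.ofReal s * φ s = ∫⁻ r in Ioo 0 s, φ s := by simp [mul_comm]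
    _ ≤ _ := setLIntegral_mono' measurableSet_Ioo fun r hr => hφ hr.1 hs hr.2.le

theorem lintegral_Ioo_mono (φ : ℝ → ℝ≥0∞) {s t : ℝ} (h : s ≤ t) :
    ∫⁻ r in Ioo 0 s, φ r ≤ ∫⁻ r in Ioo 0 t, φ r :=
  lintegral_mono_set (Ioo_subset_Ioo_right h)

theorem mul_lintegral_Ioo_le {φ : ℝ → ℝ≥0∞} (hφ : AntitoneOn φ (Ioi 0)) {s t : ℝ} (hs : 0 < s)
    (h : s ≤ t) : ENNReal.ofReal s * ∫⁻ r in Ioo 0 t, φ r ≤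
      ENNReal.ofReal t * ∫⁻ r in Ioo 0 s, φ r := by
  have h1 : ∫⁻ r in Ioo 0 t, φ r ≤
      (∫⁻ r in Ioo 0 s, φ r) + ENNReal.ofReal (t - s) * φ s := by
    calc ∫⁻ r in Ioo 0 t, φ r ≤ ∫⁻ r in Ioo 0 s ∪ Ico s t, φ r := by
          refine lintegral_mono_set fun r hr => ?_
          rcases lt_or_ge r s with h | h
          exacts [Or.inl ⟨hr.1, h⟩, Or.inr ⟨h, hr.2⟩]
      _ ≤ (∫⁻ r in Ioo 0 s, φ r) + ∫⁻ r in Ico s t, φ r := lintegral_union_le _ _ _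
      _ ≤ (∫⁻ r in Ioo 0 s, φ r) + ∫⁻ r in Ico s t, φ s := by
          gcongr 1
          exact setLIntegral_mono' measurableSet_Ico fun r hr => hφ hs (hs.trans_le hr.1) hr.1
      _ = _ := by simp [mul_comm]
  calc ENNReal.ofReal s * ∫⁻ r in Ioo 0 t, φ r
      ≤ ENNReal.ofReal s * ((∫⁻ r in Ioo 0 s, φ r) + ENNReal.ofReal (t - s) * φ s) := by gcongr
    _ = ENNReal.ofReal s * (∫⁻ r in Ioo 0 s, φ r) +
        ENNReal.ofReal (t - s) * (ENNReal.ofReal s * φ s) := by ring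
    _ ≤ ENNReal.ofReal s * (∫⁻ r in Ioo 0 s, φ r) +
        ENNReal.ofReal (t - s) * ∫⁻ r in Ioo 0 s, φ r := by
        gcongr; exact ofReal_mul_le_lintegral hφ hs
    _ = _ := by
        rw [← add_mul, ← ENNReal.ofReal_add hs.le (sub_nonneg.2 h)]; congr 2; ring

theorem antitoneOn_average {φ : ℝ → ℝ≥0∞} (hφ : AntitoneOn φ (Ioi 0)) :
    AntitoneOn (fun t => (ENNReal.ofReal t)⁻¹ * ∫⁻ s in Ioo 0 t, φ s) (Ioi 0) := by
  intro s hs t ht hst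
  have hs' : ENNReal.ofReal s ≠ 0 := by simpa using hs
  have ht' : ENNReal.ofReal t ≠ 0 := by simpa using ht
  change (ENNReal.ofReal t)⁻¹ * _ ≤ (ENNReal.ofReal s)⁻¹ * _
  rw [ENNReal.inv_mul_le_iff ht' (by simp), mul_left_comm, ← ENNReal.div_eq_inv_mul,
    ENNReal.le_div_iff_mul_le (by simp [hs']) (by simp), mul_comm]
  exact mul_lintegral_Ioo_le hφ hs hst

theorem ofReal_mul_rearrAvg {X E : Type*} [MeasurableSpace X] [NormedAddCommGroup E]
    (μ : Measure X) (f : X → E) {t : ℝ} (ht : 0 < t) :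
    ENNReal.ofReal t * rearrAvg μ f t = ∫⁻ s in Ioo 0 t, rearr μ f s := by
  rw [rearrAvg, ENNReal.mul_inv_cancel_left (by simpa using ht) (by simp)]

theorem rearr_le_rearrAvg {X E : Type*} [MeasurableSpace X] [NormedAddCommGroup E]
    (μ : Measure X) (f : X → E) {t : ℝ} (ht : 0 < t) : rearr μ f t ≤ rearrAvg μ f t := by
  have := ofReal_mul_le_lintegral ((rearr_antitone (μ := μ) f).antitoneOn (Ioi 0)) ht
  rw [← ofReal_mul_rearrAvg μ f ht] at this
  exact (ENNReal.mul_le_mul_iff_right (by simpa using ht) (by simp)).1 this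

theorem weightedNorm_mono {p : ℝ} (hp : 0 ≤ p) (w : ℝ → ℝ≥0∞) {h k : ℝ → ℝ≥0∞}
    (hhk : ∀ t, 0 < t → h t ≤ k t) : weightedNorm p w h ≤ weightedNorm p w k := by
  refine ENNReal.rpow_le_rpow (lintegral_mono_ae (ae_halfLine fun t ht => ?_)) (by positivity)
  gcongr
  exact hhk t ht

theorem lambdaNorm_le_gammaNorm {X E : Type*} [MeasurableSpace X] [NormedAddCommGroup E]
    {p : ℝ} (hp : 0 ≤ p) (w : ℝ → ℝ≥0∞) (μ : Measure X) (f : X → E) :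
    lambdaNorm p w μ f ≤ gammaNorm p w μ f :=
  weightedNorm_mono hp w fun _ ht => rearr_le_rearrAvg μ f ht

/-! ### Majorization and quasi-concave hulls -/

/-- An integral over a lower set of the line, with respect to a measure without atoms, is bounded once
the integrals over all open rays inside it are: a lower set is a ray up to a point. -/
theorem IsLowerSet.lintegral_le {m : Measure ℝ} [NullSingletonClass m] {A : Set ℝ}
    (hA : IsLowerSet A) {F : ℝ → ℝ≥0∞} {C : ℝ≥0∞}
    (h : ∀ s, Iio s ⊆ A → ∫⁻ t in Iio s, F t ∂m ≤ C) : ∫⁻ t in A, F t ∂m ≤ C := by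
  rcases A.eq_empty_or_nonempty with rfl | hne
  · simp
  by_cases hb : BddAbove A
  · have h1 : A ⊆ Iic (sSup A) := fun s hs => le_csSup hb hs
    have h2 : Iio (sSup A) ⊆ A := fun s hs => by
      obtain ⟨a, ha, hsa⟩ := exists_lt_of_lt_csSup hne hs
      exact hA hsa.le ha
    calc ∫⁻ t in A, F t ∂m ≤ ∫⁻ t in Iic (sSup A), F t ∂m := lintegral_mono_set h1
      _ = ∫⁻ t in Iio (sSup A), F t ∂m := by rw [Measure.restrict_congr_set Iio_ae_eq_Iic]
      _ ≤ C := h _ h2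
  · have h1 : ∀ s, Iio s ⊆ A := fun s t ht => by
      obtain ⟨a, ha, hsa⟩ := not_bddAbove_iff.1 hb s
      exact hA (le_of_lt ((show t < s from ht).trans hsa)) ha
    have h2 : (univ : Set ℝ) = ⋃ n : ℕ, Iio (n : ℝ) := by
      ext t; simpa using exists_nat_gt t
    calc ∫⁻ t in A, F t ∂m ≤ ∫⁻ t in ⋃ n : ℕ, Iio (n : ℝ), F t ∂m :=
          lintegral_mono_set (h2 ▸ subset_univ A)
      _ = ⨆ n : ℕ, ∫⁻ t in Iio (n : ℝ), F t ∂m := by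
          rw [setLIntegral_iUnion_of_directed]
          exact Monotone.directed_le fun a b hab => Iio_subset_Iio (by exact_mod_cast hab)
      _ ≤ C := iSup_le fun n => h _ (h1 _)

theorem IsLowerSet.measurableSet_real {A : Set ℝ} (hA : IsLowerSet A) : MeasurableSet A :=
  hA.ordConnected.measurableSet

theorem Antitone.isLowerSet_lt {h : ℝ → ℝ≥0∞} (hh : Antitone h) (c : ℝ≥0∞) :
    IsLowerSet {t | c < h t} := fun _ _ hst hs => lt_of_lt_of_le hs (hh hst)

theorem halfLine_Iio (s : ℝ) : halfLine (Iio s) = ENNReal.ofReal s := by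
  rw [halfLine, Measure.restrict_apply measurableSet_Iio, Iio_inter_Ioi, Real.volume_Ioo, sub_zero]

/-- `∫ (h - τ)₊ ≤ ∫ (k - τ)₊` for `h` non-increasing and majorized by `k`. -/
theorem lintegral_tsub_le_of_majorized {h k : ℝ → ℝ≥0∞} (hh : Antitone h)
    (hmaj : ∀ x, 0 < x → ∫⁻ t in Iio x, h t ∂halfLine ≤ ∫⁻ t in Iio x, k t ∂halfLine)
    {τ : ℝ≥0∞} (hτ : τ ≠ ∞) :
    ∫⁻ t, (h t - τ) ∂halfLine ≤ ∫⁻ t, (k t - τ) ∂halfLine := by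
  have hA := Antitone.isLowerSet_lt hh τ
  have h1 : ∫⁻ t, (h t - τ) ∂halfLine = ∫⁻ t in {t | τ < h t}, (h t - τ) ∂halfLine := by
    rw [setLIntegral_eq_of_support_subset]
    intro t ht
    exact tsub_pos_iff_lt.1 (pos_iff_ne_zero.2 ht)
  rw [h1]
  refine IsLowerSet.lintegral_le hA fun s hs => ?_
  rcases le_or_gt s 0 with hs0 | hs0
  · rw [Measure.restrict_eq_zero.2 (by rw [halfLine_Iio]; simpa using hs0)]; simp
  have hfin : τ * ENNReal.ofReal s ≠ ∞ := ENNReal.mul_ne_top hτ (by simp)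
  have hc : ∫⁻ _ in Iio s, τ ∂halfLine = τ * ENNReal.ofReal s := by
    rw [setLIntegral_const, halfLine_Iio]
  refine (ENNReal.add_le_add_iff_right hfin).1 ?_
  calc ∫⁻ t in Iio s, (h t - τ) ∂halfLine + τ * ENNReal.ofReal s
      = ∫⁻ t in Iio s, h t ∂halfLine := by
        rw [← hc, ← lintegral_add_right _ measurable_const]
        exact setLIntegral_congr_fun measurableSet_Iio fun t ht =>
          tsub_add_cancel_of_le (le_of_lt (hs ht))
    _ ≤ ∫⁻ t in Iio s, k t ∂halfLine := hmaj s hs0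
    _ ≤ ∫⁻ t in Iio s, ((k t - τ) + τ) ∂halfLine := lintegral_mono fun t => le_tsub_add
    _ = ∫⁻ t in Iio s, (k t - τ) ∂halfLine + τ * ENNReal.ofReal s := by
        rw [lintegral_add_right _ measurable_const, hc]
    _ ≤ _ := by gcongr; exact Measure.restrict_le_self

section Hull

/-- The function `θ(s) = sup_{a > 0} min(s, 1/a) (∫_0^a u)^{1/r}`. In other terms, `τ ↦ τ θ(1/τ)` is the
least quasi-concave majorant of `a ↦ (∫_0^a u)^{1/r}`. -/
def hull (r : ℝ) (u : ℝ → ℝ≥0∞) (s : ℝ) : ℝ≥0∞ :=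
  ⨆ (a : ℝ) (_ : 0 < a), min (ENNReal.ofReal s) (ENNReal.ofReal a)⁻¹ *
    (∫⁻ t in Ioo 0 a, u t) ^ (1 / r)

variable {r : ℝ} {u : ℝ → ℝ≥0∞}

theorem hull_mono : Monotone (hull r u) := fun s t hst =>
  iSup₂_mono fun a _ => by gcongr

/-- The defining estimate `(∫_0^a u)^{1/r} ≤ (1/s + a) θ(s)` of `θ = hull r u`. -/
theorem rpow_le_hull {s a : ℝ} (hs : 0 < s) (ha : 0 < a) :
    (∫⁻ t in Ioo 0 a, u t) ^ (1 / r) ≤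
      ((ENNReal.ofReal s)⁻¹ + ENNReal.ofReal a) * hull r u s := by
  set B := (∫⁻ t in Ioo 0 a, u t) ^ (1 / r)
  have hs' : ENNReal.ofReal s ≠ 0 := by simpa using hs
  have ha' : ENNReal.ofReal a ≠ 0 := by simpa using ha
  have h1 : min (ENNReal.ofReal s) (ENNReal.ofReal a)⁻¹ * B ≤ hull r u s :=
    le_iSup₂_of_le a ha le_rfl
  rcases le_total (ENNReal.ofReal s) (ENNReal.ofReal a)⁻¹ with h | h
  · rw [min_eq_left h] at h1
    calc B = (ENNReal.ofReal s)⁻¹ * (ENNReal.ofReal s * B) := by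
          rw [ENNReal.inv_mul_cancel_left hs' (by simp)]
      _ ≤ _ := by gcongr; exact le_self_add
  · rw [min_eq_right h] at h1
    calc B = ENNReal.ofReal a * ((ENNReal.ofReal a)⁻¹ * B) := by
          rw [ENNReal.mul_inv_cancel_left ha' (by simp)]
      _ ≤ _ := by gcongr; exact le_add_self

/-- The estimate `rpow_le_hull` for lower sets in place of intervals `(0, a)`. -/
theorem withDensity_rpow_le_hull (hr : 0 < r) {A : Set ℝ} (hA : IsLowerSet A) {s : ℝ}
    (hs : 0 < s) : (halfLine.withDensity u A) ^ (1 / r) ≤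
      ((ENNReal.ofReal s)⁻¹ + halfLine A) * hull r u s := by
  rw [one_div, ENNReal.rpow_inv_le_iff hr, withDensity_apply _ (IsLowerSet.measurableSet_real hA)]
  refine IsLowerSet.lintegral_le hA fun a ha => ?_
  rcases le_or_gt a 0 with ha0 | ha0
  · rw [Measure.restrict_eq_zero.2 (by rw [halfLine_Iio]; simpa using ha0)]; simp
  rw [← ENNReal.rpow_inv_le_iff hr, ← one_div, ← lintegral_Ioo_eq_halfLine]
  refine (rpow_le_hull hs ha0).trans ?_
  gcongr
  rw [← halfLine_Iio]
  exact measure_mono ha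

theorem weightedNorm_eq_withDensity (hu : AEMeasurable u halfLine) {h : ℝ → ℝ≥0∞}
    (hh : AEMeasurable h halfLine) :
    weightedNorm r u h = (∫⁻ t, h t ^ r ∂(halfLine.withDensity u)) ^ (1 / r) := by
  rw [weightedNorm, lintegral_withDensity_eq_lintegral_mul₀ hu (hh.pow_const r)]
  simp [mul_comm]

theorem indicator_one_rpow {α : Type*} (A : Set α) (x : α) (hr : 0 < r) :
    (A.indicator 1 x : ℝ≥0∞) ^ r = A.indicator 1 x := by
  by_cases hx : x ∈ A <;> simp [hx, hr]

/-- The norm of a non-increasing function is at most the integral of the norms of the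
characteristic functions of its superlevel sets. -/
theorem weightedNorm_le_lintegral_superlevel (hr : 1 ≤ r) (hu : AEMeasurable u halfLine)
    {ρ : Measure ℝ} [SFinite ρ] {G : ℝ → ℝ≥0∞} (hG : Monotone G) {h : ℝ → ℝ≥0∞}
    (hh : Antitone h) (hle : ∀ t, 0 < t → h t ≤ ρ {s | G s < h t}) :
    weightedNorm r u h ≤ ∫⁻ s, (halfLine.withDensity u {t | G s < h t}) ^ (1 / r) ∂ρ := by
  have hr0 : 0 < r := by linarith
  set S : Set (ℝ × ℝ) := {z | G z.2 < h z.1}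
  have hSm : MeasurableSet S := measurableSet_lt (hG.measurable.comp measurable_snd)
    (hh.measurable.comp measurable_fst)
  refine (weightedNorm_mono (k := fun t => ∫⁻ s, S.indicator 1 (t, s) ∂ρ) hr0.le u
    fun t ht => ?_).trans ?_
  · refine (hle t ht).trans_eq ?_
    rw [← lintegral_indicator_one (measurableSet_lt hG.measurable measurable_const)]
    rfl
  · rw [weightedNorm_eq_withDensity hu
      (measurable_one.indicator hSm).lintegral_prod_right'.aemeasurable]
    refine (lintegral_minkowski (K := fun t s => S.indicator 1 (t, s))
      (measurable_one.indicator hSm) hr).trans_eq ?_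
    refine lintegral_congr fun s => ?_
    congr 1
    simp_rw [indicator_one_rpow S _ hr0]
    rw [← lintegral_indicator_one (measurableSet_lt measurable_const hh.measurable)]
    rfl

variable {ρ : Measure ℝ} [NullSingletonClass ρ]

theorem monotone_measure_Iio (ρ : Measure ℝ) : Monotone fun s => ρ (Iio s) :=
  fun _ _ hst => measure_mono (Iio_subset_Iio hst)

/-- The probability integral transform: as `ρ` has no atoms, `s ↦ ρ(-∞, s)` pushes `ρ` forward to
Lebesgue measure on `(0, ρ(ℝ))`. This is the upper bound. -/
theorem measure_lt_measure_Iio_le (a : ℝ≥0∞) : ρ {s | ρ (Iio s) < a} ≤ a := by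
  have hA : IsLowerSet {s | ρ (Iio s) < a} :=
    fun s t hts hs => lt_of_le_of_lt (monotone_measure_Iio ρ hts) hs
  rw [← setLIntegral_one]
  refine IsLowerSet.lintegral_le hA fun s hs => ?_
  rw [setLIntegral_one]
  have h1 : Iio s = ⋃ q : {q : ℚ // (q : ℝ) < s}, Iio ((q : ℚ) : ℝ) := by
    ext x
    simp only [mem_Iio, mem_iUnion]
    constructor
    · intro hx
      obtain ⟨q, h1, h2⟩ := exists_rat_btwn hx
      exact ⟨⟨q, h2⟩, h1⟩
    · rintro ⟨q, hq⟩; exact hq.trans q.2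
  rw [h1, Directed.measure_iUnion]
  · exact iSup_le fun q => (hs q.2).le
  · refine Monotone.directed_le fun p q hpq => Iio_subset_Iio ?_
    exact_mod_cast hpq

/-- The lower bound in the probability integral transform. The assumption that `ρ` is carried by
`(0, ∞)` ensures that the sublevel set is not empty. -/
theorem le_measure_lt_measure_Iio [IsFiniteMeasure ρ] (h0 : ρ (Iic 0) = 0) {a : ℝ≥0∞} (ha : a ≤ ρ univ) :
    a ≤ ρ {s | ρ (Iio s) < a} := by
  set J := {s | ρ (Iio s) < a}
  have hA : IsLowerSet J :=
    fun s t hts hs => lt_of_le_of_lt (monotone_measure_Iio ρ hts) hs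
  rcases eq_or_ne a 0 with rfl | ha0
  · exact zero_le
  have h0J : (0 : ℝ) ∈ J := by
    refine lt_of_le_of_lt (measure_mono Iio_subset_Iic_self) ?_
    rw [h0]; exact pos_iff_ne_zero.2 ha0
  by_cases hb : BddAbove J
  · set b := sSup J
    have h2 : Iio b ⊆ J := fun s hs => by
      obtain ⟨a, ha, hsa⟩ := exists_lt_of_lt_csSup ⟨0, h0J⟩ hs
      exact hA hsa.le ha
    obtain ⟨v, hv, hvb, hvt⟩ := exists_seq_strictAnti_tendsto b
    have hI : Iic b = ⋂ n, Iio (v n) := by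
      ext x
      simp only [mem_Iic, mem_iInter, mem_Iio]
      exact ⟨fun hx n => hx.trans_lt (hvb n), fun hx => ge_of_tendsto' hvt fun n => (hx n).le⟩
    have ht := tendsto_measure_iInter_atTop (μ := ρ) (s := fun n => Iio (v n))
      (fun n => measurableSet_Iio.nullMeasurableSet)
      (fun m n hmn => Iio_subset_Iio (hv.antitone hmn)) ⟨0, measure_ne_top _ _⟩
    rw [← hI] at ht
    have h3 : a ≤ ρ (Iic b) := ge_of_tendsto' ht fun n => by
      by_contra hc
      exact absurd (le_csSup hb (show v n ∈ J from not_le.1 hc)) (not_le.2 (hvb n))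
    rw [← measure_congr (Iio_ae_eq_Iic (μ := ρ) (a := b))] at h3
    exact h3.trans (measure_mono h2)
  · have : J = univ := eq_univ_of_forall fun s => by
      obtain ⟨a, ha, hsa⟩ := not_bddAbove_iff.1 hb s
      exact hA hsa.le ha
    rwa [this]

theorem ofReal_inv_eq_halfLine {s : ℝ} (hs : 0 < s) :
    (ENNReal.ofReal s)⁻¹ = halfLine {t | s < t⁻¹} := by
  rw [← ENNReal.ofReal_inv_of_pos hs, ← halfLine_Iio]
  refine measure_congr ?_
  filter_upwards [ae_halfLine (P := fun t => 0 < t) fun t ht => ht] with t ht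
  exact propext (lt_inv_comm₀ ht hs)

/-- A non-increasing function `h` majorized by `t ↦ ρ(0, 1/t)` satisfies `‖h‖_{r,u} ≤ 2 ∫ θ(s)/s dρ(s)`.
Let `M(s)` be the length of `{h > ρ(0, s)}`. Slicing `h` at the heights `ρ(0, s)` bounds the norm by
`∫ (∫_0^{M(s)} u)^{1/r} dρ(s) ≤ ∫ (1/s + M(s)) θ(s) dρ(s)`, and as `θ` is non-decreasing, `M(s)` may be
replaced by `1/s` if `∫_J M dρ ≤ ∫_J 1/s dρ(s)` for all upper sets `J`. That inequality is
`∫ (h - τ)₊ ≤ ∫ (ρ(0, 1/t) - τ)₊ dt` for a suitable height `τ`. -/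
theorem weightedNorm_le_of_majorized [IsFiniteMeasure ρ] (hr : 1 ≤ r) (hu : AEMeasurable u halfLine)
    (h0 : ρ (Iic 0) = 0) {h : ℝ → ℝ≥0∞} (hh : Antitone h)
    (hmaj : ∀ x, 0 < x →
      ∫⁻ t in Iio x, h t ∂halfLine ≤ ∫⁻ t in Iio x, ρ (Iio t⁻¹) ∂halfLine) :
    weightedNorm r u h ≤ 2 * ∫⁻ s, (ENNReal.ofReal s)⁻¹ * hull r u s ∂ρ := by
  have hr0 : 0 < r := by linarith
  set G : ℝ → ℝ≥0∞ := fun s => ρ (Iio s)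
  have hG : Monotone G := monotone_measure_Iio ρ
  have hpos : ∀ᵐ s ∂ρ, 0 < s := by
    rw [ae_iff]; simp only [not_lt]; exact h0
  -- The averages of `h` are at most `ρ(ℝ)`, hence so is `h`, and no part of it is lost in the slicing.
  have hbound : ∀ t, 0 < t → h t ≤ ρ univ := by
    intro t ht
    have h1 := (ofReal_mul_le_lintegral (hh.antitoneOn _) ht)
    rw [lintegral_Ioo_eq_halfLine] at h1
    have h2 : ∫⁻ s in Iio t, ρ (Iio s⁻¹) ∂halfLine ≤ ENNReal.ofReal t * ρ univ := by
      refine (lintegral_mono fun s => measure_mono (subset_univ _)).trans_eq ?_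
      rw [setLIntegral_const, halfLine_Iio, mul_comm]
    exact (ENNReal.mul_le_mul_iff_right (by simpa using ht) (by simp)).1
      (h1.trans ((hmaj t ht).trans h2))
  set M : ℝ → ℝ≥0∞ := fun s => halfLine {t | G s < h t}
  set S : Set (ℝ × ℝ) := {z | G z.1 < h z.2}
  have hSm : MeasurableSet S := measurableSet_lt (hG.measurable.comp measurable_fst)
    (hh.measurable.comp measurable_snd)
  set R : Set (ℝ × ℝ) := {z | z.1 < z.2⁻¹}
  have hRm : MeasurableSet R := measurableSet_lt measurable_fst measurable_snd.inv
  have hMm : Measurable M := measurable_measure_prodMk_left hSm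
  have hinv : Measurable fun s : ℝ => (ENNReal.ofReal s)⁻¹ := by fun_prop
  have hθ : Measurable (hull r u) := hull_mono.measurable
  -- Both sides become integrals over `t` by Tonelli's theorem. With `τ = ρ(Jᶜ)`, the integrand on the
  -- left is at most `(h(t) - τ)₊`, as of two lower sets `Jᶜ` and `{G < h(t)}` one contains the other,
  -- and the integrand on the right is at least `(ρ(0, 1/t) - τ)₊`.
  have hupper : ∀ J : Set ℝ, IsUpperSet J →
      ∫⁻ s in J, M s ∂ρ ≤ ∫⁻ s in J, (ENNReal.ofReal s)⁻¹ ∂ρ := by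
    intro J hJ
    have hJm : MeasurableSet J := hJ.ordConnected.measurableSet
    have hswap : ∀ V : Set (ℝ × ℝ), MeasurableSet V →
        ∫⁻ s in J, halfLine {t | (s, t) ∈ V} ∂ρ =
          ∫⁻ t, ρ (J ∩ {s | (s, t) ∈ V}) ∂halfLine := by
      intro V hV
      calc ∫⁻ s in J, halfLine {t | (s, t) ∈ V} ∂ρ
          = ∫⁻ s in J, ∫⁻ t, V.indicator 1 (s, t) ∂halfLine ∂ρ := by
            refine lintegral_congr fun s => ?_
            rw [← lintegral_indicator_one (show MeasurableSet {t | (s, t) ∈ V} from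
              measurable_prodMk_left hV)]
            rfl
        _ = ∫⁻ t, ∫⁻ s in J, V.indicator 1 (s, t) ∂ρ ∂halfLine :=
            lintegral_lintegral_swap (measurable_one.indicator hV).aemeasurable
        _ = _ := by
            refine lintegral_congr fun t => ?_
            have hVt : MeasurableSet {s | (s, t) ∈ V} := measurable_prodMk_right hV
            rw [inter_comm, ← Measure.restrict_apply hVt, ← lintegral_indicator_one hVt]
            rfl
    set τ := ρ Jᶜ
    calc ∫⁻ s in J, M s ∂ρ = ∫⁻ t, ρ (J ∩ {s | G s < h t}) ∂halfLine := hswap S hSm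
      _ ≤ ∫⁻ t, (h t - τ) ∂halfLine := by
          refine lintegral_mono fun t => ?_
          have hL : IsLowerSet {s | G s < h t} := fun s s' hs' hs => lt_of_le_of_lt (hG hs') hs
          rcases hL.total hJ.compl with hle | hle
          · rw [show J ∩ {s | G s < h t} = ∅ from ?_]
            · simp
            · ext s; simp only [mem_inter_iff, mem_empty_iff_false, iff_false, not_and]
              exact fun hs hs' => hle hs' hs
          · refine ENNReal.le_sub_of_add_le_right (measure_ne_top _ _) ?_
            rw [← measure_union _ hJm.compl]
            · exact (measure_mono (union_subset inter_subset_right hle)).trans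
                (measure_lt_measure_Iio_le _)
            · exact disjoint_compl_right.mono_left inter_subset_left
      _ ≤ ∫⁻ t, (ρ (Iio t⁻¹) - τ) ∂halfLine :=
          lintegral_tsub_le_of_majorized hh hmaj (measure_ne_top _ _)
      _ ≤ ∫⁻ t, ρ (J ∩ {s | s < t⁻¹}) ∂halfLine := by
          refine lintegral_mono fun t => ?_
          rw [tsub_le_iff_right]
          refine (measure_mono (fun s hs => ?_)).trans (measure_union_le _ _)
          by_cases hsJ : s ∈ J
          exacts [Or.inl ⟨hsJ, hs⟩, Or.inr hsJ]
      _ = ∫⁻ s in J, halfLine {t | s < t⁻¹} ∂ρ := (hswap R hRm).symm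
      _ = ∫⁻ s in J, (ENNReal.ofReal s)⁻¹ ∂ρ := by
          refine lintegral_congr_ae ?_
          filter_upwards [ae_restrict_of_ae hpos] with s hs
          exact (ofReal_inv_eq_halfLine hs).symm
  calc weightedNorm r u h
      ≤ ∫⁻ s, (halfLine.withDensity u {t | G s < h t}) ^ (1 / r) ∂ρ :=
        weightedNorm_le_lintegral_superlevel hr hu hG hh fun t ht =>
          le_measure_lt_measure_Iio h0 (hbound t ht)
    _ ≤ ∫⁻ s, ((ENNReal.ofReal s)⁻¹ * hull r u s + M s * hull r u s) ∂ρ := by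
        refine lintegral_mono_ae ?_
        filter_upwards [hpos] with s hs
        rw [← add_mul]
        exact withDensity_rpow_le_hull hr0 (Antitone.isLowerSet_lt hh _) hs
    _ = ∫⁻ s, (ENNReal.ofReal s)⁻¹ * hull r u s ∂ρ + ∫⁻ s, M s * hull r u s ∂ρ :=
        lintegral_add_left (hinv.mul hθ) _
    _ ≤ ∫⁻ s, (ENNReal.ofReal s)⁻¹ * hull r u s ∂ρ +
          ∫⁻ s, (ENNReal.ofReal s)⁻¹ * hull r u s ∂ρ := by
        gcongr 1
        rw [lintegral_mul_eq_lintegral_superlevel hMm hθ, lintegral_mul_eq_lintegral_superlevel hinv hθ]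
        exact lintegral_mono fun l => hupper _ fun s t hst hs => lt_of_lt_of_le hs (hull_mono hst)
    _ = _ := (two_mul _).symm

end Hull

/-! ### The functions `ω_z` -/

section Bounded

variable {X E : Type*} [MeasurableSpace X] [NormedAddCommGroup E] {μ : Measure X}

theorem le_rearr {f : X → E} {t : ℝ} {c : ℝ≥0∞} (h : ENNReal.ofReal t < μ {x | c ≤ ‖f x‖ₑ}) :
    c ≤ rearr μ f t :=
  le_of_forall_lt fun _ hl => lt_rearr_iff.2 <|
    h.trans_le (measure_mono fun _ hx => hl.trans_le hx)

theorem rearr_le_indicator {f : X → E} {c : ℝ≥0∞} {A : Set X} (hf : ∀ x, ‖f x‖ₑ ≤ c)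
    (hA : ∀ x, x ∉ A → f x = 0) (t : ℝ) :
    rearr μ f t ≤ {s : ℝ | ENNReal.ofReal s < μ A}.indicator (fun _ => c) t := by
  by_cases ht : ENNReal.ofReal t < μ A
  · rw [indicator_of_mem (show t ∈ {s : ℝ | ENNReal.ofReal s < μ A} from ht), rearr_le_iff]
    rw [show {x | c < ‖f x‖ₑ} = ∅ from eq_empty_of_forall_notMem fun x hx => not_lt.2 (hf x) hx]
    simp
  · rw [indicator_of_notMem (show t ∉ {s : ℝ | ENNReal.ofReal s < μ A} from ht), rearr_le_iff]
    refine (measure_mono fun x hx => ?_).trans (not_lt.1 ht)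
    by_contra hxA
    have hx : (0 : ℝ≥0∞) < ‖f x‖ₑ := hx
    simp [hA x hxA] at hx

theorem lintegral_rearr_le_of_support {f : X → E} {c : ℝ≥0∞} {A : Set X} (hf : ∀ x, ‖f x‖ₑ ≤ c)
    (hA : ∀ x, x ∉ A → f x = 0) (t : ℝ) :
    ∫⁻ s in Ioo 0 t, rearr μ f s ≤ c * min (ENNReal.ofReal t) (μ A) := by
  have hm : MeasurableSet {s : ℝ | ENNReal.ofReal s < μ A} :=
    measurableSet_lt ENNReal.measurable_ofReal measurable_const
  refine (lintegral_mono fun s => rearr_le_indicator hf hA s).trans ?_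
  rw [lintegral_Ioo_eq_halfLine, lintegral_indicator_const hm]
  gcongr
  refine le_min ?_ ?_
  · exact (measure_mono (subset_univ _)).trans_eq
      (by rw [Measure.restrict_apply_univ, halfLine_Iio])
  · exact (Measure.restrict_apply_le _ _).trans_eq (halfLine_ofReal_lt _)

end Bounded

section Omega

variable {x : ℝ}

theorem omega_inv (x t : ℝ) : omega x⁻¹ t = min (t⁻¹ ^ 2) (x ^ 2) := by
  simp [omega]

theorem enorm_omega_inv (x t : ℝ) : ‖omega x⁻¹ t‖ₑ = ENNReal.ofReal (min (t⁻¹ ^ 2) (x ^ 2)) := by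
  rw [omega_inv, Real.enorm_of_nonneg (by positivity)]

theorem measurable_omega (z : ℝ) : Measurable (omega z) := by unfold omega; fun_prop

theorem lintegral_Ioi_inv_sq {z : ℝ} (hz : 0 < z) :
    ∫⁻ t in Ioi z, ENNReal.ofReal (t⁻¹ ^ 2) = ENNReal.ofReal z⁻¹ := by
  have h1 := integral_Ioi_rpow_of_lt (a := -2) (by norm_num) hz
  have h2 := integrableOn_Ioi_rpow_of_lt (a := -2) (by norm_num) hz
  have h3 : ∀ t ∈ Ioi z, t⁻¹ ^ 2 = t ^ (-2 : ℝ) := fun t ht => by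
    rw [Real.rpow_neg (hz.trans ht).le, inv_pow]; norm_cast
  rw [setLIntegral_congr_fun measurableSet_Ioi fun t ht => by rw [h3 t ht],
    ← ofReal_integral_eq_lintegral_ofReal h2, h1]
  · congr 1
    norm_num
    exact Real.rpow_neg_one z
  · exact (ae_restrict_iff' measurableSet_Ioi).2 (ae_of_all _ fun t ht =>
      Real.rpow_nonneg (hz.trans ht).le _)

theorem lintegral_enorm_omega_le (hx : 0 < x) :
    ∫⁻ t, ‖omega x⁻¹ t‖ₑ ∂halfLine ≤ 2 * ENNReal.ofReal x := by
  have hx' := inv_pos.2 hx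
  have : (Ioi 0 : Set ℝ) ⊆ Ioc 0 x⁻¹ ∪ Ioi x⁻¹ := by rw [Ioc_union_Ioi_eq_Ioi hx'.le]
  calc ∫⁻ t, ‖omega x⁻¹ t‖ₑ ∂halfLine
      ≤ ∫⁻ t in Ioc 0 x⁻¹ ∪ Ioi x⁻¹, ‖omega x⁻¹ t‖ₑ := lintegral_mono_set this
    _ ≤ (∫⁻ t in Ioc 0 x⁻¹, ‖omega x⁻¹ t‖ₑ) + ∫⁻ t in Ioi x⁻¹, ‖omega x⁻¹ t‖ₑ :=
        lintegral_union_le _ _ _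
    _ ≤ (∫⁻ t in Ioc 0 x⁻¹, ENNReal.ofReal (x ^ 2)) +
          ∫⁻ t in Ioi x⁻¹, ENNReal.ofReal (t⁻¹ ^ 2) := by
        gcongr with t t
        · rw [enorm_omega_inv]; exact ENNReal.ofReal_le_ofReal (min_le_right _ _)
        · rw [enorm_omega_inv]; exact ENNReal.ofReal_le_ofReal (min_le_left _ _)
    _ = 2 * ENNReal.ofReal x := by
        rw [lintegral_Ioi_inv_sq hx', setLIntegral_const, Real.volume_Ioc, inv_inv, sub_zero,
          ← ENNReal.ofReal_mul (by positivity), two_mul]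
        congr 2
        field_simp

theorem le_rearr_omega (hx : 0 < x) {s : ℝ} (hs : s < x⁻¹) :
    ENNReal.ofReal (x ^ 2) ≤ rearr halfLine (omega x⁻¹) s := by
  refine le_rearr ?_
  have hx' := inv_pos.2 hx
  refine lt_of_lt_of_le ((ENNReal.ofReal_lt_ofReal_iff hx').2 hs) ?_
  rw [← halfLine_Iio]
  refine measure_mono_ae ?_
  filter_upwards [ae_halfLine (P := fun t => 0 < t) fun t ht => ht] with t ht0 ht
  change _ ≤ ‖omega x⁻¹ t‖ₑ
  rw [enorm_omega_inv, min_eq_right]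
  exact pow_le_pow_left₀ hx.le ((le_inv_comm₀ hx ht0).2 (le_of_lt ht)) 2

/-- A lower bound for `∫_0^t ω*`, where `ω = ω_{1/x}` is at least `x²` on `(0, 1/x)`. -/
theorem min_le_lintegral_rearr_omega (hx : 0 < x) (t : ℝ) :
    ENNReal.ofReal x * min (ENNReal.ofReal x * ENNReal.ofReal t) 1 ≤
      ∫⁻ s in Ioo 0 t, rearr halfLine (omega x⁻¹) s := by
  calc ENNReal.ofReal x * min (ENNReal.ofReal x * ENNReal.ofReal t) 1
      = ENNReal.ofReal (x ^ 2) * ENNReal.ofReal (min t x⁻¹) := by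
        rw [← ENNReal.ofReal_one, ← ENNReal.ofReal_mul hx.le, ← ENNReal.ofReal_min,
          ← ENNReal.ofReal_mul hx.le, ← ENNReal.ofReal_mul (by positivity)]
        congr 1
        rw [mul_min_of_nonneg _ _ (by positivity : 0 ≤ x ^ 2), mul_min_of_nonneg _ _ hx.le]
        congr 1
        · ring
        · field_simp
    _ = ∫⁻ s in Ioo 0 (min t x⁻¹), ENNReal.ofReal (x ^ 2) := by simp
    _ ≤ ∫⁻ s in Ioo 0 (min t x⁻¹), rearr halfLine (omega x⁻¹) s :=
        setLIntegral_mono' measurableSet_Ioo fun s hs =>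
          le_rearr_omega hx (hs.2.trans_le (min_le_right _ _))
    _ ≤ _ := lintegral_mono_set (Ioo_subset_Ioo_right (min_le_left _ _))

variable {r : ℝ} {u : ℝ → ℝ≥0∞}

/-- The functions `x min(x, 1/a) 1_{(0, a)}` compete in the definition of `‖ω_{1/x}‖_{Θ_r(u)}`. -/
theorem hull_le_thetaNorm (hr : 0 < r) (hx : 0 < x) :
    ENNReal.ofReal x * hull r u x ≤ thetaNorm r u halfLine (omega x⁻¹) := by
  rw [hull, ENNReal.mul_iSup]
  refine iSup_le fun a => ?_
  rw [ENNReal.mul_iSup]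
  refine iSup_le fun ha => ?_
  set c : ℝ := x * min x a⁻¹ with hc
  have hc0 : 0 < c := by positivity
  set h : ℝ → ℝ := (Ioo 0 a).indicator fun _ => c with hh
  have hμ : halfLine (Ioo 0 a) = ENNReal.ofReal a := by
    rw [halfLine, Measure.restrict_apply measurableSet_Ioo,
      inter_eq_left.2 Ioo_subset_Ioi_self, Real.volume_Ioo, sub_zero]
  have hcE : ENNReal.ofReal c =
      ENNReal.ofReal x * min (ENNReal.ofReal x) (ENNReal.ofReal a)⁻¹ := by
    rw [hc, ENNReal.ofReal_mul hx.le, ENNReal.ofReal_min, ENNReal.ofReal_inv_of_pos ha]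
  have hle : ∀ t, 0 < t → rearrAvg halfLine h t ≤ rearrAvg halfLine (omega x⁻¹) t := by
    intro t ht
    unfold rearrAvg
    gcongr 1
    refine (lintegral_rearr_le_of_support (c := ENNReal.ofReal c) (A := Ioo 0 a) (fun s => ?_)
      (fun s hs => indicator_of_notMem hs _) t).trans
      (le_trans ?_ (min_le_lintegral_rearr_omega hx t))
    · rw [enorm_indicator_eq_indicator_enorm, Real.enorm_of_nonneg hc0.le]
      exact indicator_le_self' (fun _ _ => zero_le) s
    · rw [hcE, hμ, mul_assoc]
      gcongr
      refine le_min ?_ ?_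
      · gcongr <;> exact min_le_left _ _
      · refine (mul_le_mul' (min_le_right _ _) (min_le_right _ _)).trans ?_
        exact (ENNReal.inv_mul_cancel (by simpa using ha) (by simp)).le
  have hm : AEMeasurable h halfLine := (measurable_const.indicator measurableSet_Ioo).aemeasurable
  refine le_trans ?_ (le_iSup_of_le h (le_iSup₂_of_le hm hle le_rfl))
  rw [← mul_assoc, ← hcE]
  calc ENNReal.ofReal c * (∫⁻ t in Ioo 0 a, u t) ^ (1 / r)
      = (∫⁻ t in Ioo 0 a, ENNReal.ofReal c ^ r * u t) ^ (1 / r) := by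
        rw [lintegral_const_mul' _ _ (ENNReal.rpow_ne_top_of_nonneg hr.le (by simp)),
          ENNReal.mul_rpow_of_nonneg _ _ (by positivity), ← ENNReal.rpow_mul,
          mul_one_div_cancel hr.ne', ENNReal.rpow_one]
    _ ≤ weightedNorm r u (rearr halfLine h) := by
        refine ENNReal.rpow_le_rpow ?_ (by positivity)
        rw [lintegral_Ioo_eq_halfLine]
        refine le_trans (setLIntegral_mono' measurableSet_Iio fun t ht => ?_)
          (setLIntegral_le_lintegral (Iio a) _)
        gcongr
        refine le_rearr (lt_of_lt_of_le ((ENNReal.ofReal_lt_ofReal_iff ha).2 ht) ?_)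
        rw [← hμ]
        refine measure_mono fun s hs => ?_
        change _ ≤ ‖h s‖ₑ
        rw [hh, indicator_of_mem hs, Real.enorm_of_nonneg hc0.le]

/-- If `h** ≤ ω**` for `ω = ω_{1/x}`, then `h* ≤ x²` and `∫ h* ≤ 2x`. Slicing `h*` into characteristic
functions of intervals `(0, a)`, each of norm at most `(1/x + a) θ(x)`, gives `‖h*‖ ≤ 3 x θ(x)`. -/
theorem thetaNorm_le_hull (hr : 1 ≤ r) (hu : AEMeasurable u halfLine) (hx : 0 < x) :
    thetaNorm r u halfLine (omega x⁻¹) ≤ 3 * (ENNReal.ofReal x * hull r u x) := by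
  have hr0 : 0 < r := by linarith
  refine iSup_le fun h => iSup₂_le fun hm hle => ?_
  set H := rearr halfLine h
  have hHa : Antitone H := rearr_antitone h
  have hom := (measurable_omega x⁻¹).aestronglyMeasurable (μ := halfLine)
  have hsup : ∀ t, 0 < t → H t ≤ ENNReal.ofReal (x ^ 2) := by
    intro t ht
    refine (rearr_le_rearrAvg _ _ ht).trans ((hle t ht).trans ?_)
    rw [← ENNReal.mul_le_mul_iff_right (a := ENNReal.ofReal t) (by simpa using ht) (by simp),
      ofReal_mul_rearrAvg _ _ ht]
    calc ∫⁻ s in Ioo 0 t, rearr halfLine (omega x⁻¹) s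
        ≤ ∫⁻ s in Ioo 0 t, ENNReal.ofReal (x ^ 2) := by
          refine lintegral_mono fun s => rearr_le_iff.2 ?_
          rw [show {y | ENNReal.ofReal (x ^ 2) < ‖omega x⁻¹ y‖ₑ} = ∅ from ?_]
          · simp
          · refine eq_empty_of_forall_notMem fun y hy => ?_
            have hy : ENNReal.ofReal (x ^ 2) < ‖omega x⁻¹ y‖ₑ := hy
            rw [enorm_omega_inv] at hy
            exact absurd hy (not_lt.2 (ENNReal.ofReal_le_ofReal (min_le_right _ _)))
      _ = _ := by simp [mul_comm]
  have hint : ∫⁻ t, H t ∂halfLine ≤ 2 * ENNReal.ofReal x := by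
    rw [← setLIntegral_univ]
    refine IsLowerSet.lintegral_le isLowerSet_univ fun s _ => ?_
    rw [← lintegral_Ioo_eq_halfLine]
    rcases le_or_gt s 0 with hs | hs
    · simp [hs]
    rw [← ofReal_mul_rearrAvg _ _ hs]
    calc _ ≤ ENNReal.ofReal s * rearrAvg halfLine (omega x⁻¹) s := by gcongr; exact hle s hs
      _ = ∫⁻ s in Iio s, rearr halfLine (omega x⁻¹) s ∂halfLine := by
          rw [ofReal_mul_rearrAvg _ _ hs, lintegral_Ioo_eq_halfLine]
      _ ≤ ∫⁻ s, rearr halfLine (omega x⁻¹) s ∂halfLine := setLIntegral_le_lintegral _ _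
      _ ≤ _ := by rw [lintegral_rearr hom]; exact lintegral_enorm_omega_le hx
  have hmono : Monotone ENNReal.ofReal := ENNReal.ofReal_mono
  have hSm : MeasurableSet {z : ℝ × ℝ | ENNReal.ofReal z.1 < H z.2} :=
    measurableSet_lt (ENNReal.measurable_ofReal.comp measurable_fst)
      (hHa.measurable.comp measurable_snd)
  have hlev : MeasurableSet {l : ℝ | ENNReal.ofReal l < ENNReal.ofReal (x ^ 2)} :=
    measurableSet_lt ENNReal.measurable_ofReal measurable_const
  calc weightedNorm r u H
      ≤ ∫⁻ l, (halfLine.withDensity u {t | ENNReal.ofReal l < H t}) ^ (1 / r) ∂halfLine :=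
        weightedNorm_le_lintegral_superlevel hr hu hmono hHa fun t _ =>
          (halfLine_ofReal_lt _).ge
    _ ≤ ∫⁻ l, ({l : ℝ | ENNReal.ofReal l < ENNReal.ofReal (x ^ 2)}.indicator
          (fun _ => (ENNReal.ofReal x)⁻¹) l + halfLine {t | ENNReal.ofReal l < H t})
            * hull r u x ∂halfLine := by
        refine lintegral_mono fun l => ?_
        by_cases hl : ENNReal.ofReal l < ENNReal.ofReal (x ^ 2)
        · rw [indicator_of_mem (show l ∈ {l : ℝ | ENNReal.ofReal l < ENNReal.ofReal (x ^ 2)} from hl)]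
          exact withDensity_rpow_le_hull hr0 (Antitone.isLowerSet_lt hHa _) hx
        · have h0 : halfLine.withDensity u {t | ENNReal.ofReal l < H t} = 0 := by
            refine withDensity_absolutelyContinuous _ _ ?_
            rw [← nonpos_iff_eq_zero]
            calc halfLine {t | ENNReal.ofReal l < H t} ≤ halfLine (Iio 0) := by
                  refine measure_mono_ae ?_
                  filter_upwards [ae_halfLine hsup] with t ht hlt
                  exact absurd (lt_of_lt_of_le hlt ht) hl
              _ = 0 := by rw [halfLine_Iio]; simp
          rw [h0, ENNReal.zero_rpow_of_pos (by positivity)]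
          exact zero_le
    _ = ((ENNReal.ofReal x)⁻¹ * ENNReal.ofReal (x ^ 2) + ∫⁻ t, H t ∂halfLine) * hull r u x := by
        rw [lintegral_mul_const, lintegral_add_left (measurable_const.indicator hlev),
          lintegral_indicator_const hlev, halfLine_ofReal_lt,
          lintegral_eq_lintegral_meas_ofReal_lt hHa.measurable.aemeasurable]
        exact (measurable_const.indicator hlev).add (measurable_measure_prodMk_left hSm)
    _ ≤ (ENNReal.ofReal x + 2 * ENNReal.ofReal x) * hull r u x := by
        gcongr
        rw [← ENNReal.ofReal_inv_of_pos hx, ← ENNReal.ofReal_mul (by positivity)]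
        refine ENNReal.ofReal_le_ofReal (le_of_eq ?_)
        field_simp
    _ = _ := by ring

end Omega

/-- `‖min(1, x/·)‖_{p,w}`: the `Γ_p(w)` norm of a characteristic function of a set of measure `x`. -/
def cutoffNorm (p : ℝ) (w : ℝ → ℝ≥0∞) (x : ℝ) : ℝ≥0∞ :=
  weightedNorm p w fun s => ENNReal.ofReal (min 1 (x / s))

theorem cutoffNorm_mono {p : ℝ} (hp : 0 ≤ p) (w : ℝ → ℝ≥0∞) : Monotone (cutoffNorm p w) := by
  intro x y hxy
  refine weightedNorm_mono hp w fun t ht => ?_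
  gcongr

theorem lintegral_halfLine_comp_inv (F : ℝ → ℝ≥0∞) :
    ∫⁻ s, F s ∂halfLine = ∫⁻ t, ENNReal.ofReal (t⁻¹ ^ 2) * F t⁻¹ ∂halfLine := by
  have himg : (fun t : ℝ => t⁻¹) '' Ioi 0 = Ioi 0 := by
    ext t
    constructor
    · rintro ⟨s, hs, rfl⟩; exact inv_pos.2 (mem_Ioi.1 hs)
    · intro ht; exact ⟨t⁻¹, mem_Ioi.2 (inv_pos.2 ht), inv_inv t⟩
  unfold halfLine
  conv_lhs => rw [← himg]
  rw [lintegral_image_eq_lintegral_abs_deriv_mul measurableSet_Ioi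
    (fun t ht => (hasDerivAt_inv (ne_of_gt ht)).hasDerivWithinAt) inv_injective.injOn]
  refine setLIntegral_congr_fun measurableSet_Ioi fun t ht => ?_
  congr 2
  rw [abs_neg, abs_of_nonneg (by positivity), inv_pow]

/-- The denominators in `C_ω`, by the substitution `t ↦ 1/t`. -/
theorem weightedNorm_omega {p : ℝ} (hp : 0 < p) (w : ℝ → ℝ≥0∞) {x : ℝ} (hx : 0 < x) :
    weightedNorm (p / 2) (dualWeight p w) (fun t => ENNReal.ofReal (omega x⁻¹ t)) =
      cutoffNorm p w x ^ 2 := by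
  rw [cutoffNorm, weightedNorm, weightedNorm, ← ENNReal.rpow_two, ← ENNReal.rpow_mul,
    show 1 / p * 2 = 1 / (p / 2) by field_simp]
  congr 1
  rw [lintegral_halfLine_comp_inv fun s => ENNReal.ofReal (min 1 (x / s)) ^ p * w s]
  refine lintegral_congr_ae (ae_halfLine fun t ht => ?_)
  simp only [dualWeight]
  rw [one_div, ← mul_assoc, ← mul_assoc]
  congr 1
  have h1 : min (t⁻¹ ^ 2) (x ^ 2) = (min t⁻¹ x) ^ 2 := by
    rcases le_total t⁻¹ x with h | h
    · rw [min_eq_left h, min_eq_left (pow_le_pow_left₀ (by positivity) h 2)]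
    · rw [min_eq_right h, min_eq_right (pow_le_pow_left₀ (by positivity) h 2)]
  have h2 : min 1 (x / t⁻¹) = min t⁻¹ x * t := by
    rw [min_mul_of_nonneg _ _ ht.le, inv_mul_cancel₀ ht.ne', div_inv_eq_mul]
  have hm : 0 < min t⁻¹ x := lt_min (inv_pos.2 ht) hx
  rw [omega_inv, h1, h2, ENNReal.ofReal_rpow_of_pos (by positivity),
    ENNReal.ofReal_rpow_of_pos (by positivity), ← ENNReal.ofReal_mul (by positivity),
    ← ENNReal.ofReal_mul (by positivity)]
  congr 1
  rw [Real.mul_rpow hm.le ht.le, ← Real.rpow_natCast, ← Real.rpow_mul hm.le, Real.rpow_sub ht]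
  norm_num
  rw [mul_div_cancel₀ p two_ne_zero]
  field_simp

/-! ### The estimate of Jodeit and Torchinsky -/

/-- The square of an integral is twice the integral over the triangle `r < s`. -/
theorem sq_lintegral_eq {m : Measure ℝ} [SFinite m] [NullSingletonClass m] {φ : ℝ → ℝ≥0∞}
    (hφ : Measurable φ) :
    (∫⁻ s, φ s ∂m) ^ 2 = ∫⁻ s, 2 * ((∫⁻ r in Iio s, φ r ∂m) * φ s) ∂m := by
  have hlt : MeasurableSet {z : ℝ × ℝ | z.1 < z.2} := measurableSet_lt measurable_fst measurable_snd
  have hm : Measurable fun z : ℝ × ℝ => {z : ℝ × ℝ | z.1 < z.2}.indicator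
      (fun z => φ z.1 * φ z.2) z :=
    ((hφ.comp measurable_fst).mul (hφ.comp measurable_snd)).indicator hlt
  have h1 : ∀ s, ∫⁻ r, {z : ℝ × ℝ | z.1 < z.2}.indicator (fun z => φ z.1 * φ z.2) (r, s) ∂m =
      (∫⁻ r in Iio s, φ r ∂m) * φ s := by
    intro s
    rw [← lintegral_mul_const _ hφ, ← lintegral_indicator measurableSet_Iio]
    rfl
  have h2 : ∀ s, ∫⁻ r, φ r * φ s ∂m =
      (∫⁻ r, {z : ℝ × ℝ | z.1 < z.2}.indicator (fun z => φ z.1 * φ z.2) (r, s) ∂m) +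
      ∫⁻ r, {z : ℝ × ℝ | z.1 < z.2}.indicator (fun z => φ z.1 * φ z.2) (s, r) ∂m := by
    intro s
    rw [← lintegral_add_left (f := fun r => {z : ℝ × ℝ | z.1 < z.2}.indicator
      (fun z => φ z.1 * φ z.2) (r, s)) (hm.comp measurable_prodMk_right)]
    refine lintegral_congr_ae ?_
    have : ∀ᵐ r ∂m, r ≠ s := by simp [ae_iff]
    filter_upwards [this] with r hr
    rcases lt_or_gt_of_ne hr with h | h
    · simp [indicator, h, h.not_gt]
    · simp [indicator, h, h.not_gt, mul_comm]
  calc (∫⁻ s, φ s ∂m) ^ 2 = ∫⁻ s, ∫⁻ r, φ r * φ s ∂m ∂m := by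
        simp_rw [lintegral_mul_const _ hφ, lintegral_const_mul _ hφ, pow_two]
    _ = (∫⁻ s, (∫⁻ r in Iio s, φ r ∂m) * φ s ∂m) + ∫⁻ s, (∫⁻ r in Iio s, φ r ∂m) * φ s ∂m := by
        simp_rw [h2]
        rw [lintegral_add_left hm.lintegral_prod_left',
          lintegral_lintegral_swap (f := fun s r =>
            {z : ℝ × ℝ | z.1 < z.2}.indicator (fun z => φ z.1 * φ z.2) (s, r)) hm.aemeasurable]
        simp_rw [h1]
    _ = _ := by
        rw [← two_mul, lintegral_const_mul' _ _ (by simp)]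

/-- The primitive `∫_0^s φ`. -/
def primitive (φ : ℝ → ℝ≥0∞) (s : ℝ) : ℝ≥0∞ := ∫⁻ r in Iio s, φ r ∂halfLine

theorem primitive_eq (φ : ℝ → ℝ≥0∞) (s : ℝ) : primitive φ s = ∫⁻ r in Ioo 0 s, φ r :=
  (lintegral_Ioo_eq_halfLine φ s).symm

theorem primitive_mono (φ : ℝ → ℝ≥0∞) : Monotone (primitive φ) := fun _ _ h =>
  lintegral_mono_set (Iio_subset_Iio h)

theorem rearrAvg_eq_primitive {X E : Type*} [MeasurableSpace X] [NormedAddCommGroup E]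
    (μ : Measure X) (f : X → E) (t : ℝ) :
    rearrAvg μ f t = (ENNReal.ofReal t)⁻¹ * primitive (rearr μ f) t := by
  rw [rearrAvg, primitive_eq]

/-- Integration of the derivative of `(∫_0^s φ)²`. -/
theorem primitive_sq {φ : ℝ → ℝ≥0∞} (hφ : Measurable φ) (s : ℝ) :
    primitive φ s ^ 2 = ∫⁻ r in Iio s, 2 * (primitive φ r * φ r) ∂halfLine := by
  have : NullSingletonClass (halfLine.restrict (Iio s)) :=
    ⟨fun x => Measure.restrict_le_self.absolutelyContinuous (measure_singleton x)⟩
  rw [primitive, sq_lintegral_eq hφ]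
  refine setLIntegral_congr_fun measurableSet_Iio fun r hr => ?_
  rw [Measure.restrict_restrict measurableSet_Iio, Iio_inter_Iio, min_eq_left (le_of_lt hr)]
  rfl

theorem lintegral_Ioi_inv_sq_halfLine {s : ℝ} (hs : 0 < s) :
    ∫⁻ t in Ioi s, ENNReal.ofReal (t⁻¹ ^ 2) ∂halfLine = (ENNReal.ofReal s)⁻¹ := by
  rw [halfLine, Measure.restrict_restrict measurableSet_Ioi, Ioi_inter_Ioi, max_eq_left hs.le,
    lintegral_Ioi_inv_sq hs, ENNReal.ofReal_inv_of_pos hs]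

/-- **Hardy's inequality** in `L²(0, x)`, for bounded functions. Boundedness makes the left-hand side
finite, so that it can be cancelled. -/
theorem lintegral_average_sq_le {ψ : ℝ → ℝ≥0∞} (hψ : Measurable ψ) {c : ℝ≥0∞} (hc : c ≠ ∞)
    (hψc : ∀ t, 0 < t → ψ t ≤ c) (x : ℝ) :
    ∫⁻ t in Iio x, ((ENNReal.ofReal t)⁻¹ * primitive ψ t) ^ 2 ∂halfLine ≤
      16 * ∫⁻ t in Iio x, ψ t ^ 2 ∂halfLine := by
  set H := ∫⁻ t in Iio x, ((ENNReal.ofReal t)⁻¹ * primitive ψ t) ^ 2 ∂halfLine with hH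
  have hΨ : Measurable (primitive ψ) := (primitive_mono ψ).measurable
  have hHfin : H ≠ ∞ := by
    have : H ≤ ∫⁻ t in Iio x, c ^ 2 ∂halfLine := by
      refine lintegral_mono_ae (ae_restrict_of_ae (ae_halfLine fun t ht => ?_))
      gcongr
      rw [ENNReal.inv_mul_le_iff (by simpa using ht) (by simp)]
      calc primitive ψ t ≤ ∫⁻ r in Iio t, c ∂halfLine :=
            lintegral_mono_ae (ae_restrict_of_ae (ae_halfLine hψc))
        _ = _ := by rw [setLIntegral_const, halfLine_Iio, mul_comm]
    refine ne_top_of_le_ne_top ?_ this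
    rw [setLIntegral_const, halfLine_Iio]
    exact ENNReal.mul_ne_top (by simp [hc]) (by simp)
  have hlt : MeasurableSet {z : ℝ × ℝ | z.2 < z.1} := measurableSet_lt measurable_snd measurable_fst
  have hdm : Measurable fun r => 2 * (primitive ψ r * ψ r) := (hΨ.mul hψ).const_mul 2
  have h1 : H ≤ ∫⁻ r in Iio x, 2 * (((ENNReal.ofReal r)⁻¹ * primitive ψ r) * ψ r) ∂halfLine := by
    calc H = ∫⁻ t in Iio x, ∫⁻ r in Iio x, ENNReal.ofReal (t⁻¹ ^ 2) *
            {z : ℝ × ℝ | z.2 < z.1}.indicator (fun z => 2 * (primitive ψ z.2 * ψ z.2)) (t, r)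
              ∂halfLine ∂halfLine := by
          rw [hH]
          refine lintegral_congr_ae ?_
          filter_upwards [ae_restrict_of_ae (ae_halfLine (P := fun t => 0 < t) fun t ht => ht),
            ae_restrict_mem measurableSet_Iio] with t ht htx
          rw [mul_pow, lintegral_const_mul, primitive_sq hψ]
          · congr 1
            · rw [← ENNReal.ofReal_inv_of_pos ht, ENNReal.ofReal_pow (by positivity)]
            · rw [← lintegral_indicator measurableSet_Iio,
                ← lintegral_indicator measurableSet_Iio]
              refine lintegral_congr fun r => ?_
              by_cases hr : r < t
              · simp [indicator, hr, hr.trans htx]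
              · simp [indicator, hr]
          · exact ((hdm.comp measurable_snd).indicator hlt).comp measurable_prodMk_left
      _ = ∫⁻ r in Iio x, ∫⁻ t in Iio x, ENNReal.ofReal (t⁻¹ ^ 2) *
            {z : ℝ × ℝ | z.2 < z.1}.indicator (fun z => 2 * (primitive ψ z.2 * ψ z.2)) (t, r)
              ∂halfLine ∂halfLine := by
          refine lintegral_lintegral_swap (Measurable.aemeasurable ?_)
          exact (by fun_prop : Measurable fun z : ℝ × ℝ => ENNReal.ofReal (z.1⁻¹ ^ 2)).mul
            ((hdm.comp measurable_snd).indicator hlt)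
      _ ≤ ∫⁻ r in Iio x, (∫⁻ t in Ioi r, ENNReal.ofReal (t⁻¹ ^ 2) ∂halfLine) *
            (2 * (primitive ψ r * ψ r)) ∂halfLine := by
          refine lintegral_mono fun r => ?_
          refine (setLIntegral_le_lintegral _ _).trans_eq ?_
          rw [← lintegral_mul_const _ (by fun_prop), ← lintegral_indicator measurableSet_Ioi]
          refine lintegral_congr fun t => ?_
          by_cases hr : r < t <;> simp [indicator, hr]
      _ = _ := by
          refine lintegral_congr_ae ?_
          filter_upwards [ae_restrict_of_ae (ae_halfLine (P := fun t => 0 < t) fun t ht => ht)]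
            with r hr
          rw [lintegral_Ioi_inv_sq_halfLine hr]
          ring
  have h2 : H + H ≤ H + 16 * ∫⁻ t in Iio x, ψ t ^ 2 ∂halfLine := by
    calc H + H = 2 * H := (two_mul H).symm
      _ ≤ 2 * ∫⁻ r in Iio x, 2 * (((ENNReal.ofReal r)⁻¹ * primitive ψ r) * ψ r) ∂halfLine := by
          gcongr
      _ = ∫⁻ r in Iio x, 2 * (2 * (((ENNReal.ofReal r)⁻¹ * primitive ψ r) * ψ r)) ∂halfLine := by
          exact (lintegral_const_mul' _ _ (by simp)).symm
      -- `4aψ ≤ a² + 16ψ²`, so that one of the two copies of `H` is absorbed.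
      _ ≤ ∫⁻ r in Iio x, (((ENNReal.ofReal r)⁻¹ * primitive ψ r) ^ 2 + 16 * ψ r ^ 2) ∂halfLine := by
          refine lintegral_mono fun r => ?_
          set a := (ENNReal.ofReal r)⁻¹ * primitive ψ r
          rcases le_total (4 * ψ r) a with h | h
          · calc 2 * (2 * (a * ψ r)) = a * (4 * ψ r) := by ring
              _ ≤ a * a := by gcongr
              _ = a ^ 2 := (pow_two a).symm
              _ ≤ _ := le_self_add
          · calc 2 * (2 * (a * ψ r)) ≤ 2 * (2 * (4 * ψ r * ψ r)) := by gcongr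
              _ = 16 * ψ r ^ 2 := by ring
              _ ≤ _ := le_add_self
      _ = _ := by ring
      _ = _ := by
          rw [lintegral_add_right _ ((hψ.pow_const 2).const_mul 16),
            lintegral_const_mul _ (hψ.pow_const 2)]
  exact (ENNReal.add_le_add_iff_left hHfin).1 h2

theorem sq_eLpNorm_two {X : Type*} [MeasurableSpace X] {μ : Measure X} (f : X → ℂ) :
    eLpNorm f 2 μ ^ 2 = ∫⁻ x, ‖f x‖ₑ ^ 2 ∂μ := by
  rw [eLpNorm_eq_lintegral_rpow_enorm_toReal two_ne_zero ENNReal.ofNat_ne_top]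
  norm_num
  rw [← ENNReal.rpow_two, ← ENNReal.rpow_mul]
  norm_num

theorem add_sq_le_four_mul (a b : ℝ≥0∞) : (a + b) ^ 2 ≤ 4 * a ^ 2 + 4 * b ^ 2 := by
  rcases le_total a b with h | h
  · calc (a + b) ^ 2 ≤ (b + b) ^ 2 := by gcongr
      _ = 4 * b ^ 2 := by ring
      _ ≤ _ := le_add_self
  · calc (a + b) ^ 2 ≤ (a + a) ^ 2 := by gcongr
      _ = 4 * a ^ 2 := by ring
      _ ≤ _ := le_self_add

/-- The decomposition of `f` into the part above height `τ` and the part cut off at height `τ`. -/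
theorem exists_truncation {X : Type*} [MeasurableSpace X] {μ : Measure X} [IsProbabilityMeasure μ]
    (f : Lp ℂ 1 μ) {τ : ℝ≥0∞} (hτ : τ ≠ ∞) :
    ∃ f₁ f₂ : Lp ℂ 1 μ, f = f₁ + f₂ ∧ MemLp f₂ 2 μ ∧ (∀ᵐ x ∂μ, ‖f₁ x‖ₑ = ‖f x‖ₑ - τ) ∧
      ∀ᵐ x ∂μ, ‖f₂ x‖ₑ = min ‖f x‖ₑ τ := by
  set c := τ.toReal
  have hc : 0 ≤ c := ENNReal.toReal_nonneg
  have hcτ : ENNReal.ofReal c = τ := ENNReal.ofReal_toReal hτ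
  set k : X → ℝ := fun x => min ‖f x‖ c / ‖f x‖
  set g : X → ℂ := fun x => k x • f x with hg
  have hfm := Lp.aestronglyMeasurable f
  have hgm : AEStronglyMeasurable g μ := by
    have : AEMeasurable k μ := by
      have := hfm.norm.aemeasurable
      exact (this.min aemeasurable_const).div this
    exact this.aestronglyMeasurable.smul hfm
  have hgn : ∀ x, ‖g x‖ = min ‖f x‖ c := by
    intro x
    rw [hg, norm_smul, Real.norm_of_nonneg (by positivity)]
    rcases eq_or_ne ‖f x‖ 0 with h | h
    · simp [h, hc]
    · exact div_mul_cancel₀ _ h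
  have hfg : ∀ x, ‖f x - g x‖ = ‖f x‖ - min ‖f x‖ c := by
    intro x
    have h1 : f x - g x = (1 - k x) • f x := by simp [hg, sub_smul]
    have hk1 : k x ≤ 1 := div_le_one_of_le₀ (min_le_left _ _) (norm_nonneg _)
    rw [h1, norm_smul, Real.norm_of_nonneg (by linarith), ← hgn x, hg, norm_smul,
      Real.norm_of_nonneg (by positivity)]
    ring
  have hg1 : MemLp g 1 μ := (Lp.memLp f).of_le hgm (ae_of_all _ fun x => by
    rw [hgn]; exact min_le_left _ _)
  have hg2 : MemLp g 2 μ := MemLp.of_bound hgm c (ae_of_all _ fun x => by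
    rw [hgn]; exact min_le_right _ _)
  refine ⟨f - hg1.toLp g, hg1.toLp g, by simp, hg2.ae_eq hg1.coeFn_toLp.symm, ?_, ?_⟩
  · filter_upwards [Lp.coeFn_sub f (hg1.toLp g), hg1.coeFn_toLp] with x h1 h2
    rw [h1, Pi.sub_apply, h2, ← ofReal_norm, ← ofReal_norm, hfg, ← hcτ,
      ← ENNReal.ofReal_sub _ hc]
    rcases le_total ‖f x‖ c with h | h
    · rw [min_eq_left h, sub_self, ENNReal.ofReal_zero, ENNReal.ofReal_of_nonpos (by linarith)]
    · rw [min_eq_right h]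
  · filter_upwards [hg1.coeFn_toLp] with x h2
    rw [h2, ← ofReal_norm, ← ofReal_norm, hgn, ← hcτ, ENNReal.ofReal_min]

/-- The estimate of Jodeit and Torchinsky for operators of type `(1, ∞)` and `(2, 2)`. The part of `f`
above height `f*(1/x)` is estimated in `L¹`, the part below in `L²`. -/
theorem IsSublinearOfType.exists_lintegral_rearr_sq_le {X Y : Type*} [MeasurableSpace X]
    [MeasurableSpace Y] {μ : Measure X} {ν : Measure Y} [IsProbabilityMeasure μ] [SFinite ν]
    {T : Lp ℂ 1 μ → (Y →ₘ[ν] ℂ)} (hT : IsSublinearOfType μ ν T) :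
    ∃ K : ℝ≥0, ∀ (f : Lp ℂ 1 μ) (x : ℝ), 0 < x →
      ∫⁻ t in Iio x, rearr ν (T f) t ^ 2 ∂halfLine ≤
        K * ∫⁻ t in Iio x, primitive (rearr μ f) t⁻¹ ^ 2 ∂halfLine := by
  obtain ⟨M₁, hM₁⟩ := hT.bound_one
  obtain ⟨M₂, hM₂⟩ := hT.bound_two
  refine ⟨4 * M₁ ^ 2 + 4 * M₂ ^ 2 * 2, fun f x hx => ?_⟩
  set φ := rearr μ f
  have hφa : Antitone φ := rearr_antitone f
  have hfm := Lp.aestronglyMeasurable f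
  set Φ := primitive φ with hΦ
  set I := ∫⁻ t in Iio x, Φ t⁻¹ ^ 2 ∂halfLine with hI
  have hx' : 0 < x⁻¹ := inv_pos.2 hx
  have hΦmul : ∀ s, 0 < s → ENNReal.ofReal s * φ s ≤ Φ s := fun s hs => by
    rw [hΦ, primitive_eq]; exact ofReal_mul_le_lintegral (hφa.antitoneOn _) hs
  set τ := φ x⁻¹
  have hτ : τ ≠ ∞ := by
    have h1 : ENNReal.ofReal x⁻¹ * τ ≤ ∫⁻ t, φ t ∂halfLine :=
      (hΦmul _ hx').trans (setLIntegral_le_lintegral _ _)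
    rw [lintegral_rearr hfm, ← eLpNorm_one_eq_lintegral_enorm] at h1
    intro h
    rw [h, ENNReal.mul_top (by simpa using hx)] at h1
    exact (Lp.memLp f).eLpNorm_ne_top (top_le_iff.1 h1)
  obtain ⟨f₁, f₂, hf, hf₂, hn₁, hn₂⟩ := exists_truncation f hτ
  have hmain : ENNReal.ofReal x * Φ x⁻¹ ^ 2 ≤ I := by
    calc ENNReal.ofReal x * Φ x⁻¹ ^ 2 = ∫⁻ t in Iio x, Φ x⁻¹ ^ 2 ∂halfLine := by
          rw [setLIntegral_const, halfLine_Iio, mul_comm]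
      _ ≤ I := by
          refine lintegral_mono_ae ?_
          filter_upwards [ae_restrict_of_ae (ae_halfLine (P := fun t => 0 < t) fun t ht => ht),
            ae_restrict_mem measurableSet_Iio] with t ht htx
          gcongr
          exact primitive_mono φ (inv_anti₀ ht (le_of_lt htx))
  have h₁ : eLpNorm f₁ 1 μ ≤ Φ x⁻¹ := by
    rw [eLpNorm_one_eq_lintegral_enorm, lintegral_congr_ae hn₁, ← lintegral_rearr_tsub hfm,
      hΦ, primitive, ← lintegral_indicator measurableSet_Iio]
    refine lintegral_mono fun t => ?_
    by_cases ht : t < x⁻¹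
    · rw [indicator_of_mem (show t ∈ Iio x⁻¹ from ht)]; exact tsub_le_self
    · rw [tsub_eq_zero_of_le (hφa (not_lt.1 ht))]; exact zero_le
  have htail : ∫⁻ t in Ici x⁻¹, φ t ^ 2 ∂halfLine ≤ I := by
    rw [← lintegral_indicator measurableSet_Ici, lintegral_halfLine_comp_inv,
      hI, ← lintegral_indicator measurableSet_Iio]
    have hne : ∀ᵐ t ∂halfLine, t ≠ x := by simp [ae_iff]
    refine lintegral_mono_ae ?_
    filter_upwards [ae_halfLine (P := fun t => 0 < t) fun t ht => ht, hne] with t ht htx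
    by_cases h : x⁻¹ ≤ t⁻¹
    · have h' : t < x := lt_of_le_of_ne ((inv_le_inv₀ hx ht).1 h) htx
      rw [indicator_of_mem (show t⁻¹ ∈ Ici x⁻¹ from h), indicator_of_mem (show t ∈ Iio x from h'),
        ENNReal.ofReal_pow (by positivity), ← mul_pow]
      gcongr
      exact hΦmul _ (inv_pos.2 ht)
    · rw [indicator_of_notMem (show t⁻¹ ∉ Ici x⁻¹ from h), mul_zero]; exact zero_le
  have h₂ : ∫⁻ y, ‖f₂ y‖ₑ ^ 2 ∂μ ≤ 2 * I := by
    rw [lintegral_congr_ae (hn₂.mono fun y hy => by rw [hy]), ← lintegral_min_rearr_sq hfm,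
      ← lintegral_add_compl _ (measurableSet_Iio (a := x⁻¹)), two_mul, compl_Iio]
    refine add_le_add ?_ ((lintegral_mono fun t => ?_).trans htail)
    · refine le_trans (lintegral_mono (g := fun _ => τ ^ 2) fun t => ?_) (le_trans ?_ hmain)
      · exact pow_le_pow_left' (min_le_right _ _) 2
      · rw [setLIntegral_const, halfLine_Iio]
        calc τ ^ 2 * ENNReal.ofReal x⁻¹
            = ENNReal.ofReal x * (ENNReal.ofReal x⁻¹ * τ) ^ 2 := by
              have : ENNReal.ofReal x * ENNReal.ofReal x⁻¹ = 1 := by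
                rw [← ENNReal.ofReal_mul hx.le, mul_inv_cancel₀ hx.ne', ENNReal.ofReal_one]
              calc τ ^ 2 * ENNReal.ofReal x⁻¹
                  = (ENNReal.ofReal x * ENNReal.ofReal x⁻¹) * (τ ^ 2 * ENNReal.ofReal x⁻¹) := by
                    rw [this, one_mul]
                _ = _ := by ring
          _ ≤ _ := by gcongr; exact hΦmul _ hx'
    · exact pow_le_pow_left' (min_le_left _ _) 2
  have hA : ∀ᵐ y ∂ν, ‖T f y‖ₑ ≤ M₁ * Φ x⁻¹ + ‖T f₂ y‖ₑ := by
    filter_upwards [hT.add_le f₁ f₂, enorm_ae_le_eLpNormEssSup (T f₁) ν] with y h1 h2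
    have h3 : ‖T f y‖ₑ ≤ ‖T f₁ y‖ₑ + ‖T f₂ y‖ₑ := by
      rw [hf, ← ofReal_norm, ← ofReal_norm, ← ofReal_norm,
        ← ENNReal.ofReal_add (norm_nonneg _) (norm_nonneg _)]
      exact ENNReal.ofReal_le_ofReal h1
    refine h3.trans (add_le_add (h2.trans ?_) le_rfl)
    rw [← eLpNorm_exponent_top]
    exact (hM₁ f₁).trans (by gcongr)
  calc ∫⁻ t in Iio x, rearr ν (T f) t ^ 2 ∂halfLine
      ≤ ∫⁻ t in Iio x, (4 * (M₁ * Φ x⁻¹) ^ 2 + 4 * rearr ν (T f₂) t ^ 2) ∂halfLine := by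
        refine lintegral_mono fun t => ?_
        exact (pow_le_pow_left' (rearr_le_add hA t) 2).trans (add_sq_le_four_mul _ _)
    _ = 4 * M₁ ^ 2 * (ENNReal.ofReal x * Φ x⁻¹ ^ 2) +
          4 * ∫⁻ t in Iio x, rearr ν (T f₂) t ^ 2 ∂halfLine := by
        rw [lintegral_add_left measurable_const, setLIntegral_const, halfLine_Iio,
          lintegral_const_mul' _ _ (by simp)]
        ring
    _ ≤ 4 * M₁ ^ 2 * I + 4 * (M₂ ^ 2 * (2 * I)) := by
        gcongr
        refine (setLIntegral_le_lintegral _ _).trans ?_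
        rw [lintegral_rearr_sq (T f₂).aestronglyMeasurable, ← sq_eLpNorm_two]
        calc eLpNorm (T f₂) 2 ν ^ 2 ≤ (M₂ * eLpNorm f₂ 2 μ) ^ 2 := by gcongr; exact hM₂ f₂ hf₂
          _ = M₂ ^ 2 * ∫⁻ y, ‖f₂ y‖ₑ ^ 2 ∂μ := by rw [mul_pow, sq_eLpNorm_two]
          _ ≤ _ := by gcongr
    _ = _ := by push_cast; ring

/-! ### Sufficiency of `C_ω < ∞` -/

section LevelLength

variable {φ : ℝ → ℝ≥0∞}

/-- The derivative `φ(s) · (1/s) ∫_0^s φ` of `(∫_0^s φ)²` with respect to `s²`. The value `∞` for `s ≤ 0`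
makes it non-increasing on the whole line. -/
def sqSlope (φ : ℝ → ℝ≥0∞) (s : ℝ) : ℝ≥0∞ :=
  if s ≤ 0 then ∞ else φ s * ((ENNReal.ofReal s)⁻¹ * primitive φ s)

theorem sqSlope_of_pos (φ : ℝ → ℝ≥0∞) {s : ℝ} (hs : 0 < s) :
    sqSlope φ s = φ s * ((ENNReal.ofReal s)⁻¹ * primitive φ s) := if_neg (not_le.2 hs)

theorem average_antitoneOn (hφ : Antitone φ) :
    AntitoneOn (fun s => (ENNReal.ofReal s)⁻¹ * primitive φ s) (Ioi 0) := by
  simp_rw [primitive_eq]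
  exact antitoneOn_average (hφ.antitoneOn _)

theorem sqSlope_antitone (hφ : Antitone φ) : Antitone (sqSlope φ) := by
  intro s t hst
  rcases le_or_gt s 0 with hs | hs
  · rw [sqSlope, sqSlope, if_pos hs]; exact le_top
  · rw [sqSlope_of_pos φ hs, sqSlope_of_pos φ (hs.trans_le hst)]
    exact mul_le_mul' (hφ hst) (average_antitoneOn hφ hs (hs.trans_le hst) hst)

/-- The length of the superlevel set of `sqSlope φ` at height `l`. It is finite where it is used, for
functions `φ` that vanish on `[1, ∞)`. -/
def levelLength (φ : ℝ → ℝ≥0∞) (l : ℝ) : ℝ :=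
  (halfLine {s | ENNReal.ofReal l < sqSlope φ s}).toReal

theorem halfLine_superlevel_le_one (hφ1 : ∀ t, 1 ≤ t → φ t = 0) (l : ℝ) :
    halfLine {s | ENNReal.ofReal l < sqSlope φ s} ≤ 1 := by
  rw [← ENNReal.ofReal_one, ← halfLine_Iio 1]
  refine measure_mono fun s hs => ?_
  by_contra hs1
  have hs1 : 1 ≤ s := not_lt.1 hs1
  have hs : ENNReal.ofReal l < sqSlope φ s := hs
  rw [sqSlope_of_pos φ (by linarith), hφ1 s hs1, zero_mul] at hs
  exact absurd hs not_lt_zero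

theorem ofReal_levelLength (hφ1 : ∀ t, 1 ≤ t → φ t = 0) (l : ℝ) :
    ENNReal.ofReal (levelLength φ l) = halfLine {s | ENNReal.ofReal l < sqSlope φ s} :=
  ENNReal.ofReal_toReal (ne_top_of_le_ne_top ENNReal.one_ne_top (halfLine_superlevel_le_one hφ1 l))

theorem levelLength_nonneg (l : ℝ) : 0 ≤ levelLength φ l := ENNReal.toReal_nonneg

theorem levelLength_le_one (hφ1 : ∀ t, 1 ≤ t → φ t = 0) (l : ℝ) : levelLength φ l ≤ 1 :=
  ENNReal.toReal_le_of_le_ofReal zero_le_one (by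
    rw [ENNReal.ofReal_one]; exact halfLine_superlevel_le_one hφ1 l)

theorem measurable_levelLength (hφ1 : ∀ t, 1 ≤ t → φ t = 0) : Measurable (levelLength φ) := by
  refine Antitone.measurable fun l l' hl => ENNReal.toReal_mono
    (ne_top_of_le_ne_top ENNReal.one_ne_top (halfLine_superlevel_le_one hφ1 l))
    (measure_mono fun s hs => lt_of_le_of_lt (ENNReal.ofReal_le_ofReal hl) hs)

theorem le_levelLength (hφ : Antitone φ) (hφ1 : ∀ t, 1 ≤ t → φ t = 0) {l s : ℝ}
    (hs : ENNReal.ofReal l < sqSlope φ s) : s ≤ levelLength φ l := by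
  refine (ENNReal.ofReal_le_ofReal_iff (levelLength_nonneg l)).1 ?_
  rw [ofReal_levelLength hφ1, ← halfLine_Iio s]
  exact measure_mono fun t ht =>
    hs.trans_le (sqSlope_antitone hφ (le_of_lt (show t < s from ht)))

theorem lt_sqSlope (hφ : Antitone φ) {l s : ℝ} (hs : s < levelLength φ l) :
    ENNReal.ofReal l < sqSlope φ s := by
  by_contra h
  rcases le_or_gt s 0 with hs0 | hs0
  · rw [sqSlope, if_pos hs0] at h
    exact h ENNReal.ofReal_lt_top
  · refine absurd hs (not_lt.2 (ENNReal.toReal_le_of_le_ofReal hs0.le ?_))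
    rw [← halfLine_Iio s]
    refine measure_mono fun t ht => ?_
    by_contra hts
    exact h (lt_of_lt_of_le ht (sqSlope_antitone hφ (not_lt.1 hts)))

/-- Layer by layer: `θ` is at most `θ(x)` on the superlevel set `(0, x)` of `sqSlope φ`. -/
theorem lintegral_mul_sqSlope_le (hφ : Antitone φ) (hφ1 : ∀ t, 1 ≤ t → φ t = 0)
    {θ : ℝ → ℝ≥0∞} (hθ : Monotone θ) :
    ∫⁻ s, θ s * sqSlope φ s ∂halfLine ≤
      ∫⁻ l, ENNReal.ofReal (levelLength φ l) * θ (levelLength φ l) ∂halfLine := by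
  rw [lintegral_mul_eq_lintegral_superlevel hθ.measurable (sqSlope_antitone hφ).measurable]
  refine lintegral_mono fun l => ?_
  rw [ofReal_levelLength hφ1, mul_comm, ← setLIntegral_const]
  exact setLIntegral_mono' (IsLowerSet.measurableSet_real
    (Antitone.isLowerSet_lt (sqSlope_antitone hφ) _))
    fun s hs => hθ (le_levelLength hφ hφ1 hs)

theorem ofReal_sq_eq_lintegral (s : ℝ) :
    ENNReal.ofReal s ^ 2 = ∫⁻ r in Iio s, 2 * ENNReal.ofReal r ∂halfLine := by
  have h := primitive_sq (φ := fun _ => 1) measurable_const s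
  simpa [primitive, halfLine_Iio] using h

/-- The squared average of `φ` is the integral over `l` of the functions `s ↦ min(1, x(l)/s)²`, where `x`
is `levelLength φ`, because `(∫_0^s φ)²` is the integral of `sqSlope φ` with respect to `d(r²)`.
This is the half of the equality that matters here. -/
theorem lintegral_cutoff_sq_le (hφ : Antitone φ) {s : ℝ}
    (hs : 0 < s) : ∫⁻ l, ENNReal.ofReal (min 1 (levelLength φ l / s)) ^ 2 ∂halfLine ≤
      ((ENNReal.ofReal s)⁻¹ * primitive φ s) ^ 2 := by
  have hγ := sqSlope_antitone hφ
  have h1 : primitive φ s ^ 2 =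
      ∫⁻ r in Iio s, 2 * ENNReal.ofReal r * sqSlope φ r ∂halfLine := by
    rw [primitive_sq hφ.measurable]
    refine lintegral_congr_ae (ae_restrict_of_ae (ae_halfLine fun r hr => ?_))
    simp only
    rw [sqSlope_of_pos φ hr, mul_assoc, mul_left_comm (ENNReal.ofReal r),
      ENNReal.mul_inv_cancel_left (by simpa using hr) (by simp), mul_comm (φ r)]
  rw [mul_pow, h1, lintegral_mul_eq_lintegral_superlevel (by fun_prop) hγ.measurable,
    ← lintegral_const_mul' _ _ (by simp [hs])]
  refine lintegral_mono fun l => ?_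
  have hsub : Iio (min s (levelLength φ l)) ⊆ {r | ENNReal.ofReal l < sqSlope φ r} ∩ Iio s :=
    fun r hr => ⟨lt_sqSlope hφ (lt_of_lt_of_le hr (min_le_right _ _)),
      mem_Iio.2 (lt_of_lt_of_le hr (min_le_left _ _))⟩
  rw [Measure.restrict_restrict (IsLowerSet.measurableSet_real
    (Antitone.isLowerSet_lt hγ _))]
  refine le_trans (le_of_eq ?_) (mul_le_mul' le_rfl (lintegral_mono_set hsub))
  rw [← ofReal_sq_eq_lintegral, ← mul_pow, ← ENNReal.ofReal_inv_of_pos hs,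
    ← ENNReal.ofReal_mul (by positivity), mul_min_of_nonneg _ _ (by positivity),
    inv_mul_cancel₀ hs.ne', div_eq_inv_mul]

/-- The functional `‖·‖_{p/2}` is superadditive for `p ≤ 2`, so it can be bounded from below on the
integral of the functions `min(1, x/s)²`. This is Minkowski's inequality with the exponent `2/p ≥ 1`. -/
theorem lintegral_cutoffNorm_sq_le (hφ : Antitone φ) (hφ1 : ∀ t, 1 ≤ t → φ t = 0) {p : ℝ}
    (hp : 0 < p) (hp2 : p ≤ 2) {w : ℝ → ℝ≥0∞} (hw : AEMeasurable w halfLine) :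
    ∫⁻ l, cutoffNorm p w (levelLength φ l) ^ 2 ∂halfLine ≤
      weightedNorm p w (fun s => (ENNReal.ofReal s)⁻¹ * primitive φ s) ^ 2 := by
  have hP : 1 ≤ 2 / p := by rw [le_div_iff₀ hp]; linarith
  have hxm := measurable_levelLength (φ := φ) hφ1
  have hK : Measurable (Function.uncurry fun l s : ℝ =>
      ENNReal.ofReal (min 1 (levelLength φ l / s)) ^ p) := by
    unfold Function.uncurry
    have : Measurable fun z : ℝ × ℝ => levelLength φ z.1 := hxm.comp measurable_fst
    fun_prop
  have hmain := lintegral_minkowski (μ := halfLine) (ν := halfLine.withDensity w) hK hP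
  have havg : AEMeasurable (fun s => (ENNReal.ofReal s)⁻¹ * primitive φ s) halfLine :=
    aemeasurable_restrict_of_antitoneOn measurableSet_Ioi (average_antitoneOn hφ)
  have hleft : ∀ l, (∫⁻ s, ENNReal.ofReal (min 1 (levelLength φ l / s)) ^ p
      ∂(halfLine.withDensity w)) ^ (2 / p) = cutoffNorm p w (levelLength φ l) ^ 2 := by
    intro l
    rw [cutoffNorm, weightedNorm_eq_withDensity hw (by fun_prop), ← ENNReal.rpow_two,
      ← ENNReal.rpow_mul]
    congr 1
    field_simp
  rw [one_div_div] at hmain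
  simp_rw [hleft] at hmain
  rw [weightedNorm_eq_withDensity hw havg, ← ENNReal.rpow_two, ← ENNReal.rpow_mul,
    show 1 / p * 2 = (p / 2)⁻¹ by field_simp, ENNReal.le_rpow_inv_iff (by positivity)]
  refine hmain.trans (lintegral_mono_ae ?_)
  refine (withDensity_absolutelyContinuous halfLine w).ae_le (ae_halfLine fun s hs => ?_)
  calc (∫⁻ l, (ENNReal.ofReal (min 1 (levelLength φ l / s)) ^ p) ^ (2 / p) ∂halfLine) ^ (p / 2)
      = (∫⁻ l, ENNReal.ofReal (min 1 (levelLength φ l / s)) ^ 2 ∂halfLine) ^ (p / 2) := by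
        congr 1
        refine lintegral_congr fun l => ?_
        rw [← ENNReal.rpow_mul, mul_div_cancel₀ _ hp.ne', ENNReal.rpow_two]
    _ ≤ (((ENNReal.ofReal s)⁻¹ * primitive φ s) ^ 2) ^ (p / 2) :=
        ENNReal.rpow_le_rpow (lintegral_cutoff_sq_le hφ hs) (by positivity)
    _ = _ := by
        rw [← ENNReal.rpow_two, ← ENNReal.rpow_mul]
        congr 1
        field_simp

end LevelLength

theorem hull_le_two_mul_hull_half (r : ℝ) (u : ℝ → ℝ≥0∞) (x : ℝ) :
    hull r u x ≤ 2 * hull r u (x / 2) := by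
  refine iSup₂_le fun a ha => ?_
  refine le_trans ?_ (mul_le_mul' le_rfl (le_iSup₂_of_le a ha le_rfl))
  rw [← mul_assoc]
  gcongr
  have h : ENNReal.ofReal x = 2 * ENNReal.ofReal (x / 2) := by
    rw [← ENNReal.ofReal_ofNat 2, ← ENNReal.ofReal_mul (by norm_num)]
    congr 1; ring
  rcases le_total (ENNReal.ofReal (x / 2)) (ENNReal.ofReal a)⁻¹ with h' | h'
  · rw [min_eq_left h', h]; exact min_le_left _ _
  · rw [min_eq_right h']
    exact (min_le_right _ _).trans (le_mul_of_one_le_left' (by norm_num))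

/-- The constant is `C_ω + 1` because `C_ω = 0` gives no bound for `‖ω_z‖_Θ` when the denominator is `∞`
(the product `0 * ∞` is `0`). -/
theorem thetaNorm_le_of_COmega_lt_top {p q : ℝ} (hp : 0 < p) {u w : ℝ → ℝ≥0∞}
    (h : COmega p q u w < ∞) {x : ℝ} (hx : 0 < x) (hx1 : x < 1) :
    thetaNorm (q / 2) u halfLine (omega x⁻¹) ≤ (COmega p q u w + 1) * cutoffNorm p w x ^ 2 := by
  have h1 : thetaNorm (q / 2) u halfLine (omega x⁻¹) / cutoffNorm p w x ^ 2 ≤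
      COmega p q u w := by
    rw [← weightedNorm_omega hp w hx]
    exact le_iSup₂ (f := fun (z : ℝ) (_ : 1 < z) => thetaNorm (q / 2) u halfLine (omega z) /
      weightedNorm (p / 2) (dualWeight p w) (fun t => ENNReal.ofReal (omega z t)))
      x⁻¹ ((one_lt_inv₀ hx).2 hx1)
  have h2 := h1.trans (le_self_add (b := 1))
  have h3 : COmega p q u w + 1 ≠ ∞ := by simp [h.ne]
  rwa [ENNReal.div_le_iff_le_mul (Or.inr h3) (Or.inr (by simp))] at h2

/-- The supremum `C_ω` only covers `x < 1`; the value at `x/2` serves for `x = 1` as well. -/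
theorem hull_le_of_COmega_lt_top {p q : ℝ} (hp : 0 < p) (hq : 0 < q) {u w : ℝ → ℝ≥0∞}
    (h : COmega p q u w < ∞) {x : ℝ} (hx : 0 ≤ x) (hx1 : x ≤ 1) :
    ENNReal.ofReal x * hull (q / 2) u x ≤
      4 * (COmega p q u w + 1) * cutoffNorm p w x ^ 2 := by
  rcases hx.eq_or_lt with rfl | hx
  · simp
  have h2 : ENNReal.ofReal x = 2 * ENNReal.ofReal (x / 2) := by
    rw [← ENNReal.ofReal_ofNat 2, ← ENNReal.ofReal_mul (by norm_num)]
    congr 1; ring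
  calc ENNReal.ofReal x * hull (q / 2) u x
      ≤ (2 * ENNReal.ofReal (x / 2)) * (2 * hull (q / 2) u (x / 2)) := by
        rw [h2]; gcongr; exact hull_le_two_mul_hull_half _ _ _
    _ = 4 * (ENNReal.ofReal (x / 2) * hull (q / 2) u (x / 2)) := by ring
    _ ≤ 4 * ((COmega p q u w + 1) * cutoffNorm p w x ^ 2) := by
        refine mul_le_mul' le_rfl ?_
        refine (hull_le_thetaNorm (by positivity) (by positivity)).trans
          ((thetaNorm_le_of_COmega_lt_top (x := x / 2) hp h (by positivity) (by linarith)).trans ?_)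
        exact mul_le_mul' le_rfl (pow_le_pow_left' (cutoffNorm_mono hp.le w (by linarith)) 2)
    _ = _ := by ring

theorem sq_weightedNorm {q : ℝ} (hq : 0 < q) (u h : ℝ → ℝ≥0∞) :
    weightedNorm q u h ^ 2 = weightedNorm (q / 2) u fun t => h t ^ 2 := by
  rw [weightedNorm, weightedNorm, ← ENNReal.rpow_two, ← ENNReal.rpow_mul,
    show 1 / q * 2 = 1 / (q / 2) by field_simp]
  congr 1
  refine lintegral_congr fun t => ?_
  rw [← ENNReal.rpow_two, ← ENNReal.rpow_mul, mul_div_cancel₀ q two_ne_zero]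

/-- Finiteness of `C_ω` suffices for all admissible operators. -/
theorem IsSublinearOfType.exists_gammaNorm_le {X Y : Type*} [MeasurableSpace X]
    [MeasurableSpace Y] {μ : Measure X} {ν : Measure Y} [IsProbabilityMeasure μ] [SFinite ν]
    {T : Lp ℂ 1 μ → (Y →ₘ[ν] ℂ)} (hT : IsSublinearOfType μ ν T) {p q : ℝ} (hp : 0 < p)
    (hp2 : p ≤ 2) (hq : 2 ≤ q) {u w : ℝ → ℝ≥0∞} (hu : AEMeasurable u halfLine)
    (hw : AEMeasurable w halfLine) (hC : COmega p q u w < ∞) :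
    ∃ C : ℝ≥0, ∀ f : Lp ℂ 1 μ, gammaNorm q u ν (T f) ≤ C * gammaNorm p w μ f := by
  obtain ⟨K, hK⟩ := hT.exists_lintegral_rearr_sq_le
  obtain ⟨M₁, hM₁⟩ := hT.bound_one
  set D : ℝ≥0∞ := 256 * K * (COmega p q u w + 1) with hD
  have hDfin : D ≠ ∞ := ENNReal.mul_ne_top (ENNReal.mul_ne_top (by simp) (by simp))
    (by simp [hC.ne])
  suffices hsq : ∀ f : Lp ℂ 1 μ, gammaNorm q u ν (T f) ^ 2 ≤ D * gammaNorm p w μ f ^ 2 by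
    refine ⟨(D ^ (1 / 2 : ℝ)).toNNReal, fun f => ?_⟩
    rw [ENNReal.coe_toNNReal (ENNReal.rpow_ne_top_of_nonneg (by norm_num) hDfin)]
    refine (ENNReal.pow_le_pow_left_iff two_ne_zero).1 ((hsq f).trans_eq ?_)
    rw [mul_pow, ← ENNReal.rpow_two (D ^ (1 / 2 : ℝ)), ← ENNReal.rpow_mul]
    norm_num
  intro f
  set φ := rearr μ f
  have hφ : Antitone φ := rearr_antitone f
  have hφm := hφ.measurable
  have hφ1 : ∀ t, 1 ≤ t → φ t = 0 := by
    intro t ht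
    refine nonpos_iff_eq_zero.1 (rearr_le_iff.2 (prob_le_one.trans ?_))
    rw [← ENNReal.ofReal_one]; exact ENNReal.ofReal_le_ofReal ht
  have hφint : ∫⁻ t, φ t ∂halfLine ≠ ∞ := by
    rw [lintegral_rearr (Lp.aestronglyMeasurable f), ← eLpNorm_one_eq_lintegral_enorm]
    exact (Lp.memLp f).eLpNorm_ne_top
  have hΦm : Measurable (primitive φ) := (primitive_mono φ).measurable
  -- The density of the measure `ρ` with `ρ(0, s) = 16 K (∫_0^s φ)²`.
  set d : ℝ → ℝ≥0∞ := fun s => 16 * K * (2 * (primitive φ s * φ s)) with hd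
  have hdm : Measurable d := ((hΦm.mul hφm).const_mul 2).const_mul _
  set ρ := halfLine.withDensity d with hρ
  have hρnull : NullSingletonClass ρ :=
    ⟨fun x => withDensity_absolutelyContinuous _ _ (measure_singleton x)⟩
  have hρfin : IsFiniteMeasure ρ := by
    refine isFiniteMeasure_withDensity ?_
    rw [hd, lintegral_const_mul' _ _ (ENNReal.mul_ne_top (by simp) (by simp))]
    refine ENNReal.mul_ne_top (ENNReal.mul_ne_top (by simp) (by simp)) ?_
    have := sq_lintegral_eq (m := halfLine) hφm
    change ∫⁻ s, 2 * ((∫⁻ r in Iio s, φ r ∂halfLine) * φ s) ∂halfLine ≠ ∞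
    rw [← this]
    exact ENNReal.pow_ne_top hφint
  have hρ0 : ρ (Iic 0) = 0 := by
    refine withDensity_absolutelyContinuous _ _ ?_
    rw [← measure_congr (Iio_ae_eq_Iic (μ := halfLine) (a := 0)), halfLine_Iio,
      ENNReal.ofReal_zero]
  have hρI : ∀ s, ρ (Iio s) = 16 * K * primitive φ s ^ 2 := by
    intro s
    rw [hρ, withDensity_apply _ measurableSet_Iio, hd,
      lintegral_const_mul' _ _ (ENNReal.mul_ne_top (by simp) (by simp)), primitive_sq hφm]
  set ψ := rearr ν (T f)
  -- The function `(Tf)**²`, with the value `∞` for `t ≤ 0` to make it non-increasing on the line.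
  set h : ℝ → ℝ≥0∞ := fun t =>
    if t ≤ 0 then ∞ else ((ENNReal.ofReal t)⁻¹ * primitive ψ t) ^ 2 with hh
  have hpos : ∀ t, 0 < t → h t = ((ENNReal.ofReal t)⁻¹ * primitive ψ t) ^ 2 :=
    fun t ht => if_neg (not_le.2 ht)
  have hha : Antitone h := by
    intro s t hst
    rcases le_or_gt s 0 with hs | hs
    · simp [hh, hs]
    · rw [hpos s hs, hpos t (hs.trans_le hst)]
      exact pow_le_pow_left' (average_antitoneOn (rearr_antitone _) hs (hs.trans_le hst) hst) 2
  have hψc : ∀ t, ψ t ≤ M₁ * eLpNorm f 1 μ := by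
    intro t
    refine rearr_le_iff.2 ?_
    rw [measure_eq_zero_iff_ae_notMem.2]
    · exact zero_le
    · filter_upwards [enorm_ae_le_eLpNormEssSup (T f) ν] with y hy
      rw [← eLpNorm_exponent_top] at hy
      exact not_lt.2 (hy.trans (hM₁ f))
  have hmaj : ∀ x, 0 < x →
      ∫⁻ t in Iio x, h t ∂halfLine ≤ ∫⁻ t in Iio x, ρ (Iio t⁻¹) ∂halfLine := by
    intro x hx
    calc ∫⁻ t in Iio x, h t ∂halfLine
        = ∫⁻ t in Iio x, ((ENNReal.ofReal t)⁻¹ * primitive ψ t) ^ 2 ∂halfLine :=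
          lintegral_congr_ae (ae_restrict_of_ae (ae_halfLine hpos))
      _ ≤ 16 * ∫⁻ t in Iio x, ψ t ^ 2 ∂halfLine :=
          lintegral_average_sq_le (measurable_rearr _)
            (ENNReal.mul_ne_top (by simp) (Lp.memLp f).eLpNorm_ne_top) (fun t _ => hψc t) x
      _ ≤ 16 * (K * ∫⁻ t in Iio x, primitive φ t⁻¹ ^ 2 ∂halfLine) := by
          gcongr; exact hK f x hx
      _ = ∫⁻ t in Iio x, ρ (Iio t⁻¹) ∂halfLine := by
          simp_rw [hρI]
          rw [lintegral_const_mul' _ _ (ENNReal.mul_ne_top (by simp) (by simp)), mul_assoc]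
  calc gammaNorm q u ν (T f) ^ 2 = weightedNorm (q / 2) u fun t => rearrAvg ν (T f) t ^ 2 :=
        sq_weightedNorm (by linarith) _ _
    _ ≤ weightedNorm (q / 2) u h := weightedNorm_mono (by linarith) _ fun t ht => by
        rw [hpos t ht, rearrAvg_eq_primitive]
    _ ≤ 2 * ∫⁻ s, (ENNReal.ofReal s)⁻¹ * hull (q / 2) u s ∂ρ :=
        weightedNorm_le_of_majorized (by linarith) hu hρ0 hha hmaj
    _ = 2 * ∫⁻ s, 32 * K * (hull (q / 2) u s * sqSlope φ s) ∂halfLine := by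
        rw [hρ, lintegral_withDensity_eq_lintegral_mul _ hdm
          (g := fun s => (ENNReal.ofReal s)⁻¹ * hull (q / 2) u s)
          ((by fun_prop : Measurable fun s : ℝ => (ENNReal.ofReal s)⁻¹).mul hull_mono.measurable)]
        congr 1
        refine lintegral_congr_ae (ae_halfLine fun s hs => ?_)
        simp only [Pi.mul_apply]
        rw [sqSlope_of_pos φ hs, hd]
        ring
    _ = 64 * K * ∫⁻ s, hull (q / 2) u s * sqSlope φ s ∂halfLine := by
        rw [lintegral_const_mul' _ _ (ENNReal.mul_ne_top (by simp) (by simp))]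
        ring
    _ ≤ 64 * K * ∫⁻ l, ENNReal.ofReal (levelLength φ l) * hull (q / 2) u (levelLength φ l)
          ∂halfLine := by
        exact mul_le_mul' le_rfl (lintegral_mul_sqSlope_le hφ hφ1 hull_mono)
    _ ≤ 64 * K * ∫⁻ l, 4 * (COmega p q u w + 1) * cutoffNorm p w (levelLength φ l) ^ 2
          ∂halfLine := by
        refine mul_le_mul' le_rfl (lintegral_mono fun l => ?_)
        exact hull_le_of_COmega_lt_top hp (by linarith) hC (levelLength_nonneg l)
          (levelLength_le_one hφ1 l)
    _ = D * ∫⁻ l, cutoffNorm p w (levelLength φ l) ^ 2 ∂halfLine := by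
        rw [lintegral_const_mul' _ _ (ENNReal.mul_ne_top (by simp) (by simp [hC.ne])), hD]
        ring
    _ ≤ D * gammaNorm p w μ f ^ 2 := by
        gcongr
        refine (lintegral_cutoffNorm_sq_le hφ hφ1 hp hp2 hw).trans_eq ?_
        rw [gammaNorm]
        congr 2
        funext t
        rw [rearrAvg_eq_primitive]

/-! ### Test functions with flat Fourier coefficients -/

section Gauss

/-- Quadratic Gauss sums with a linear term have modulus `√N` for odd `N`. -/
theorem normSq_sum_stdAddChar_quadratic {N : ℕ} [NeZero N] (hN : Odd N) (n : ZMod N) :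
    ‖∑ a : ZMod N, (ZMod.stdAddChar (a ^ 2 - n * a) : ℂ)‖ ^ 2 = N := by
  set ψ : AddChar (ZMod N) ℂ := ZMod.stdAddChar
  have hconj : ∀ a, starRingEnd ℂ (ψ a) = ψ (-a) := fun a => (AddChar.map_neg_eq_conj ψ a).symm
  have h2 : IsUnit (2 : ZMod N) := by
    have := (ZMod.isUnit_iff_coprime 2 N).2 (Nat.coprime_two_left.2 hN)
    exact_mod_cast this
  have key : (∑ a, ψ (a ^ 2 - n * a)) * starRingEnd ℂ (∑ a, ψ (a ^ 2 - n * a)) = N := by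
    calc (∑ a, ψ (a ^ 2 - n * a)) * starRingEnd ℂ (∑ a, ψ (a ^ 2 - n * a))
        = ∑ b, ∑ a, ψ (a ^ 2 - n * a) * ψ (-(b ^ 2 - n * b)) := by
          rw [map_sum, Finset.sum_mul_sum, Finset.sum_comm]
          simp_rw [hconj]
      _ = ∑ b, ∑ c, ψ (c ^ 2 - n * c) * ψ (b * (2 * c)) := by
          refine Finset.sum_congr rfl fun b _ => ?_
          rw [← Equiv.sum_comp (Equiv.addLeft b)]
          refine Finset.sum_congr rfl fun c _ => ?_
          rw [← AddChar.map_add_eq_mul, ← AddChar.map_add_eq_mul, Equiv.coe_addLeft]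
          congr 1; ring
      _ = ∑ c, ψ (c ^ 2 - n * c) * ∑ b, ψ (b * (2 * c)) := by
          rw [Finset.sum_comm]
          simp_rw [Finset.mul_sum]
      _ = ∑ c, ψ (c ^ 2 - n * c) * if c = 0 then (N : ℂ) else 0 := by
          refine Finset.sum_congr rfl fun c _ => ?_
          rw [AddChar.sum_mulShift _ (ZMod.isPrimitive_stdAddChar N), ZMod.card]
          simp [h2.mul_right_eq_zero]
      _ = N := by simp
  have := Complex.mul_conj (∑ a, ψ (a ^ 2 - n * a))
  rw [key, Complex.normSq_eq_norm_sq] at this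
  exact_mod_cast this.symm

theorem sum_range_eq_sum_zmod {N : ℕ} [NeZero N] (F : ZMod N → ℂ) :
    ∑ j ∈ Finset.range N, F (j : ZMod N) = ∑ a : ZMod N, F a := by
  refine Finset.sum_nbij' (fun j => (j : ZMod N)) (fun a => a.val) (by simp)
    (fun a _ => by simpa using ZMod.val_lt a) (fun j hj => ?_) (fun a _ => ?_) (by simp)
  · exact ZMod.val_cast_of_lt (by simpa using hj)
  · exact ZMod.natCast_zmod_val a

end Gauss

section Chirp

variable (N : ℕ) [NeZero N] (δ : ℝ)

/-- The function on `ℝ` that equals `e(j² / N)` on `[j/N, (j + δ)/N)` for integers `j`, and zero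
elsewhere. -/
def chirp (x : ℝ) : ℂ :=
  if Int.fract (N * x) < δ then ZMod.stdAddChar (((⌊N * x⌋ : ℤ) : ZMod N) ^ 2) else 0

/-- The function on the circle given by `chirp` on `[0, 1)`. -/
def circleChirp : UnitAddCircle → ℂ := AddCircle.liftIco 1 0 (chirp N δ)

theorem norm_chirp_le (x : ℝ) : ‖chirp N δ x‖ ≤ 1 := by
  unfold chirp
  split_ifs
  · rw [ZMod.stdAddChar_apply, Circle.norm_coe]
  · simp

theorem measurable_chirp : Measurable (chirp N δ) := by
  unfold chirp
  refine Measurable.ite (measurableSet_lt (by fun_prop) measurable_const) ?_ measurable_const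
  exact (measurable_of_countable fun k : ℤ => (ZMod.stdAddChar ((k : ZMod N) ^ 2) : ℂ)).comp
    (Int.measurable_floor.comp (by fun_prop))

theorem measurable_circleChirp : Measurable (circleChirp N δ) :=
  ((measurable_chirp N δ).comp measurable_subtype_coe).comp
    (AddCircle.measurableEquivIco (1 : ℝ) 0).measurable

theorem norm_circleChirp_le (y : UnitAddCircle) : ‖circleChirp N δ y‖ ≤ 1 :=
  norm_chirp_le N δ _

theorem haarAddCircle_eq_volume :
    (AddCircle.haarAddCircle : Measure UnitAddCircle) = volume := by
  have := AddCircle.volume_eq_smul_haarAddCircle (T := 1)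
  rw [ENNReal.ofReal_one, one_smul] at this
  exact this.symm

theorem integrable_circleChirp : Integrable (circleChirp N δ) AddCircle.haarAddCircle :=
  Integrable.of_bound (measurable_circleChirp N δ).aestronglyMeasurable 1
    (ae_of_all _ (norm_circleChirp_le N δ))

variable {δ}

theorem haar_support_circleChirp_le :
    AddCircle.haarAddCircle {y | circleChirp N δ y ≠ 0} ≤ ENNReal.ofReal δ := by
  have hN : (0 : ℝ) < N := by exact_mod_cast NeZero.pos N
  have hm : MeasurableSet {y | circleChirp N δ y ≠ 0} :=
    (measurable_circleChirp N δ) (measurableSet_singleton (0 : ℂ)).compl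
  rw [haarAddCircle_eq_volume,
    ← (UnitAddCircle.measurePreserving_mk 0).measure_preimage hm.nullMeasurableSet,
    Measure.restrict_congr_set Ioo_ae_eq_Ioc.symm]
  have hsub : ((fun x : ℝ => (x : UnitAddCircle)) ⁻¹' {y | circleChirp N δ y ≠ 0}) ∩ Ioo 0 (0 + 1) ⊆
      ⋃ j ∈ Finset.range N, Ico ((j : ℝ) / N) ((j + δ) / N) := by
    rintro x ⟨hx, hx0, hx1⟩
    rw [zero_add] at hx1
    have hx : circleChirp N δ (x : UnitAddCircle) ≠ 0 := hx
    rw [circleChirp, AddCircle.liftIco_zero_coe_apply ⟨hx0.le, hx1⟩, chirp] at hx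
    have hfr : Int.fract (N * x) < δ := by
      by_contra h; exact hx (if_neg h)
    have hpos : 0 ≤ (N : ℝ) * x := by positivity
    have h1 := Nat.floor_le hpos
    have h2 := Int.self_sub_floor (N * x)
    rw [← natCast_floor_eq_intCast_floor hpos] at h2
    simp only [mem_iUnion, Finset.mem_range]
    refine ⟨⌊N * x⌋₊, ?_, ?_, ?_⟩
    · rw [Nat.floor_lt hpos]; nlinarith
    · rw [div_le_iff₀ hN]; linarith
    · rw [lt_div_iff₀ hN]; linarith
  rw [Measure.restrict_apply ((AddCircle.measurable_mk') hm)]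
  calc _ ≤ volume (⋃ j ∈ Finset.range N, Ico ((j : ℝ) / N) ((j + δ) / N)) := measure_mono hsub
    _ ≤ ∑ j ∈ Finset.range N, volume (Ico ((j : ℝ) / N) ((j + δ) / N)) :=
        measure_biUnion_finset_le _ _
    _ = N * ENNReal.ofReal (δ / N) := by
        simp_rw [Real.volume_Ico, ← sub_div, add_sub_cancel_left]
        simp
    _ = ENNReal.ofReal δ := by
        rw [← ENNReal.ofReal_natCast, ← ENNReal.ofReal_mul hN.le, mul_div_cancel₀ _ hN.ne']

/-- The character `x ↦ e(-n x)` of the line. -/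
def lineChar (n : ℤ) (x : ℝ) : ℂ := Complex.exp (2 * Real.pi * Complex.I * (-n : ℤ) * x)

theorem continuous_lineChar (n : ℤ) : Continuous (lineChar n) := by
  unfold lineChar; fun_prop

theorem lineChar_add (n : ℤ) (x y : ℝ) : lineChar n (x + y) = lineChar n x * lineChar n y := by
  rw [lineChar, lineChar, lineChar, ← Complex.exp_add]
  congr 1; push_cast; ring

theorem norm_lineChar (n : ℤ) (x : ℝ) : ‖lineChar n x‖ = 1 := by
  rw [lineChar, show (2 * Real.pi * Complex.I * (-n : ℤ) * x : ℂ) =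
    ((2 * Real.pi * (-n : ℤ) * x : ℝ) : ℂ) * Complex.I by push_cast; ring,
    Complex.norm_exp_ofReal_mul_I]

theorem re_lineChar (n : ℤ) (x : ℝ) : (lineChar n x).re = Real.cos (2 * Real.pi * n * x) := by
  rw [lineChar, show (2 * Real.pi * Complex.I * (-n : ℤ) * x : ℂ) =
    ((-(2 * Real.pi * n * x) : ℝ) : ℂ) * Complex.I by push_cast; ring,
    Complex.exp_ofReal_mul_I_re, Real.cos_neg]

theorem fourierCoeff_circleChirp_eq (n : ℤ) :
    fourierCoeff (circleChirp N δ) n = ∫ x in (0 : ℝ)..1, lineChar n x * chirp N δ x := by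
  rw [circleChirp, fourierCoeff_eq_intervalIntegral _ _ 0, zero_add, div_one, one_smul]
  refine intervalIntegral.integral_congr_Ioo_of_le zero_le_one fun x hx => ?_
  rw [AddCircle.liftIco_zero_coe_apply ⟨hx.1.le, hx.2⟩, fourier_coe_apply, lineChar, smul_eq_mul]
  simp

theorem intervalIntegrable_chirp (n : ℤ) (a b : ℝ) :
    IntervalIntegrable (fun x => lineChar n x * chirp N δ x) volume a b := by
  rw [intervalIntegrable_iff]
  refine Measure.integrableOn_of_bounded (M := 1) (by simp) ?_ (ae_of_all _ fun x => ?_)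
  · exact ((continuous_lineChar n).measurable.mul (measurable_chirp N δ)).aestronglyMeasurable
  · rw [norm_mul, norm_lineChar, one_mul]; exact norm_chirp_le N δ x

theorem integral_chirp_piece (hδ0 : 0 < δ) (hδ1 : δ < 1) (n : ℤ) (j : ℕ) :
    ∫ x in ((j : ℝ) / N)..(((j + 1 : ℕ) : ℝ) / N), lineChar n x * chirp N δ x =
      lineChar n (j / N) * ZMod.stdAddChar ((j : ZMod N) ^ 2) *
        ∫ x in (0 : ℝ)..(δ / N), lineChar n x := by
  have hN : (0 : ℝ) < N := by exact_mod_cast NeZero.pos N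
  have hδN : δ / N ≤ 1 / N := by gcongr
  have h1 := intervalIntegral.integral_comp_add_right (a := 0) (b := 1 / N)
    (fun x => lineChar n x * chirp N δ x) ((j : ℝ) / N)
  rw [show (0 : ℝ) + j / N = j / N by ring, show 1 / N + (j : ℝ) / N = ((j + 1 : ℕ) : ℝ) / N by
    push_cast; ring] at h1
  rw [← h1, ← intervalIntegral.integral_const_mul]
  have hval : ∀ x ∈ Ioo (0 : ℝ) (1 / N), lineChar n (x + j / N) * chirp N δ (x + j / N) =
      (Iio (δ / N)).indicator
        (fun x => lineChar n (j / N) * ZMod.stdAddChar ((j : ZMod N) ^ 2) * lineChar n x) x := by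
    intro x hx
    have hx1 : N * x < 1 := by have := hx.2; rwa [lt_div_iff₀ hN, mul_comm] at this
    have hx0 : 0 ≤ N * x := mul_nonneg hN.le hx.1.le
    have hNx : N * (x + j / N) = N * x + (j : ℤ) := by push_cast; field_simp
    have hfl : ⌊(N : ℝ) * x⌋ = 0 := Int.floor_eq_zero_iff.2 ⟨hx0, hx1⟩
    rw [chirp, hNx, Int.fract_add_intCast, Int.floor_add_intCast, hfl,
      Int.fract_eq_self.2 ⟨hx0, hx1⟩, lineChar_add]
    by_cases h : x < δ / N
    · have h' : N * x < δ := by rwa [lt_div_iff₀ hN, mul_comm] at h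
      rw [if_pos h', indicator_of_mem (show x ∈ Iio (δ / N) from h)]
      push_cast
      rw [zero_add]; ring
    · have h' : ¬ N * x < δ := by rwa [lt_div_iff₀ hN, mul_comm] at h
      rw [if_neg h', indicator_of_notMem (show x ∉ Iio (δ / N) from h), mul_zero]
  rw [intervalIntegral.integral_of_le (by positivity), intervalIntegral.integral_of_le
    (by positivity), integral_Ioc_eq_integral_Ioo, setIntegral_congr_fun measurableSet_Ioo hval,
    setIntegral_indicator measurableSet_Iio, Ioo_inter_Iio, min_eq_right hδN,
    integral_Ioc_eq_integral_Ioo]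

theorem lineChar_mul_stdAddChar (n : ℤ) (j : ℕ) :
    lineChar n (j / N) * ZMod.stdAddChar ((j : ZMod N) ^ 2) =
      (ZMod.stdAddChar ((j : ZMod N) ^ 2 - (n : ZMod N) * (j : ZMod N)) : ℂ) := by
  have h : lineChar n (j / N) = (ZMod.stdAddChar (-((n : ZMod N) * (j : ZMod N))) : ℂ) := by
    have := ZMod.stdAddChar_coe (N := N) (-(n * j))
    push_cast at this
    rw [this, lineChar]
    congr 1; push_cast; ring
  rw [h, ← AddChar.map_add_eq_mul]
  congr 1; ring

/-- The Fourier coefficients of `circleChirp` are Gauss sums times those of a single pulse. -/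
theorem fourierCoeff_circleChirp (hδ0 : 0 < δ) (hδ1 : δ < 1) (n : ℤ) :
    fourierCoeff (circleChirp N δ) n =
      (∑ a : ZMod N, (ZMod.stdAddChar (a ^ 2 - (n : ZMod N) * a) : ℂ)) *
        ∫ x in (0 : ℝ)..(δ / N), lineChar n x := by
  have hN : (N : ℝ) ≠ 0 := by exact_mod_cast NeZero.ne N
  have h := intervalIntegral.sum_integral_adjacent_intervals (μ := volume)
    (a := fun j : ℕ => (j : ℝ) / N) (n := N)
    (f := fun x => lineChar n x * chirp N δ x) fun k _ => intervalIntegrable_chirp N n _ _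
  simp only [Nat.cast_zero, zero_div, div_self hN] at h
  rw [fourierCoeff_circleChirp_eq, ← h, ← sum_range_eq_sum_zmod, Finset.sum_mul]
  refine Finset.sum_congr rfl fun j _ => ?_
  rw [integral_chirp_piece N hδ0 hδ1, lineChar_mul_stdAddChar]

theorem le_norm_integral_lineChar {a : ℝ} (ha : 0 ≤ a) {n : ℤ} (hn : |(n : ℝ)| * a ≤ 1 / 6) :
    a / 2 ≤ ‖∫ x in (0 : ℝ)..a, lineChar n x‖ := by
  have hre : (∫ x in (0 : ℝ)..a, lineChar n x).re = ∫ x in (0 : ℝ)..a, (lineChar n x).re :=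
    (Complex.reCLM.intervalIntegral_comp_comm
      ((continuous_lineChar n).intervalIntegrable 0 a)).symm
  refine le_trans ?_ (Complex.re_le_norm _)
  rw [hre]
  calc a / 2 = ∫ x in (0 : ℝ)..a, (1 / 2 : ℝ) := by simp; ring
    _ ≤ _ := by
      refine intervalIntegral.integral_mono_on ha (by simp)
        ((Complex.continuous_re.comp (continuous_lineChar n)).intervalIntegrable 0 a)
        fun x hx => ?_
      rw [re_lineChar, ← Real.cos_abs, ← Real.cos_pi_div_three]
      refine Real.cos_le_cos_of_nonneg_of_le_pi (abs_nonneg _) (by linarith [Real.pi_pos]) ?_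
      rw [abs_mul, abs_mul, abs_of_pos Real.two_pi_pos, abs_of_nonneg hx.1, mul_assoc]
      have : |(n : ℝ)| * x ≤ 1 / 6 := (mul_le_mul_of_nonneg_left hx.2 (abs_nonneg _)).trans hn
      nlinarith [Real.pi_pos]

theorem le_norm_fourierCoeff_circleChirp (hN : Odd N) (hδ0 : 0 < δ) (hδ1 : δ < 1) {n : ℤ}
    (hn : |(n : ℝ)| * (δ / N) ≤ 1 / 6) :
    δ / (2 * √N) ≤ ‖fourierCoeff (circleChirp N δ) n‖ := by
  have hN0 : (0 : ℝ) < N := by exact_mod_cast NeZero.pos N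
  rw [fourierCoeff_circleChirp N hδ0 hδ1, norm_mul]
  have h1 : ‖∑ a : ZMod N, (ZMod.stdAddChar (a ^ 2 - (n : ZMod N) * a) : ℂ)‖ = √N := by
    rw [← normSq_sum_stdAddChar_quadratic hN (n : ZMod N), Real.sqrt_sq (norm_nonneg _)]
  rw [h1]
  calc δ / (2 * √N) = √N * (δ / N / 2) := by
        have hs : √N * √N = N := Real.mul_self_sqrt hN0.le
        have hs0 : √(N : ℝ) ≠ 0 := (Real.sqrt_pos.2 hN0).ne'
        field_simp
        nlinarith
    _ ≤ _ := by gcongr; exact le_norm_integral_lineChar (by positivity) hn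

end Chirp

/-- There are at least `y` integers in `[-y, y]`. -/
theorem le_count_abs_le {y : ℝ} (hy : 0 ≤ y) :
    ENNReal.ofReal y ≤ Measure.count {n : ℤ | |(n : ℝ)| ≤ y} := by
  have hfin : {n : ℤ | |(n : ℝ)| ≤ y} = ↑(Finset.Icc (-⌊y⌋) ⌊y⌋) := by
    ext n
    simp only [mem_ofPred_eq, Finset.coe_Icc, mem_Icc, abs_le, Int.le_floor, neg_le (a := ⌊y⌋)]
    push_cast
    rw [neg_le (a := y)]
  rw [hfin, Measure.count_apply_finset, Int.card_Icc, ← ENNReal.ofReal_natCast]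
  refine ENNReal.ofReal_le_ofReal ?_
  have h0 : 0 ≤ ⌊y⌋ := Int.floor_nonneg.2 hy
  have h1 : (((⌊y⌋ + 1 - -⌊y⌋).toNat : ℤ) : ℝ) = ⌊y⌋ + 1 + ⌊y⌋ := by
    rw [Int.toNat_of_nonneg (by linarith)]; push_cast; ring
  rw [← Int.cast_natCast, h1]
  have h2 := (Int.lt_floor_add_one y).le
  have h3 : (0 : ℝ) ≤ ⌊y⌋ := by exact_mod_cast h0
  linarith

/-! ### Necessity of `C_ω < ∞` -/

theorem gammaNorm_le_cutoffNorm {X E : Type*} [MeasurableSpace X] [NormedAddCommGroup E]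
    {μ : Measure X} {f : X → E} (hf : ∀ y, ‖f y‖ₑ ≤ 1) {x : ℝ}
    (hx : μ {y | f y ≠ 0} ≤ ENNReal.ofReal x) {p : ℝ} (hp : 0 ≤ p) (w : ℝ → ℝ≥0∞) :
    gammaNorm p w μ f ≤ cutoffNorm p w x := by
  refine weightedNorm_mono hp w fun t ht => ?_
  have ht' : ENNReal.ofReal t ≠ 0 := by simpa using ht
  rw [rearrAvg, ENNReal.inv_mul_le_iff ht' (by simp)]
  refine (lintegral_rearr_le_of_support hf (A := {y | f y ≠ 0})
    (fun y hy => by simpa using hy) t).trans ?_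
  rw [one_mul, ← ENNReal.ofReal_mul ht.le, mul_min_of_nonneg _ _ ht.le, mul_one,
    mul_div_cancel₀ _ ht.ne', ENNReal.ofReal_min]
  exact min_le_min le_rfl hx

/-- The Fourier coefficient inequality for the functions `circleChirp` bounds `hull`. -/
theorem hull_le_of_fourier_bound {p q : ℝ} (hp : 0 < p) (hq : 0 < q) {u w : ℝ → ℝ≥0∞} {C : ℝ≥0}
    (hC : ∀ f : UnitAddCircle → ℂ, Integrable f AddCircle.haarAddCircle →
      lambdaNorm q u Measure.count (fourierCoeff f) ≤
        C * gammaNorm p w AddCircle.haarAddCircle f) {x : ℝ} (hx : 0 < x) (hx1 : x < 1) :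
    ENNReal.ofReal x * hull (q / 2) u x ≤ 36 * C ^ 2 * cutoffNorm p w x ^ 2 := by
  rw [hull, ENNReal.mul_iSup]
  refine iSup_le fun a => ?_
  rw [ENNReal.mul_iSup]
  refine iSup_le fun ha => ?_
  set y := max a x⁻¹ with hy
  have hx' : 0 < x⁻¹ := inv_pos.2 hx
  have hy0 : 0 < y := lt_of_lt_of_le ha (le_max_left _ _)
  have hxy : 1 ≤ x * y := by
    rw [← mul_inv_cancel₀ hx.ne']
    exact mul_le_mul_of_nonneg_left (le_max_right _ _) hx.le
  -- The pulses have length `x/N ≤ 1/(6y)`, so that the coefficients are large for all `|n| ≤ y`.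
  set N : ℕ := 2 * ⌈3 * (x * y)⌉₊ + 1 with hN
  have hNodd : Odd N := ⟨_, rfl⟩
  have : NeZero N := ⟨by omega⟩
  have hN1 : 6 * (x * y) ≤ N := by
    have := Nat.le_ceil (3 * (x * y))
    rw [hN]; push_cast; linarith
  have hN2 : N ≤ 9 * (x * y) := by
    have := (Nat.ceil_lt_add_one (by positivity : 0 ≤ 3 * (x * y))).le
    rw [hN]; push_cast; linarith
  have hN0 : (0 : ℝ) < N := by exact_mod_cast NeZero.pos N
  set c : ℝ := x / (2 * √N) with hc
  have hc0 : 0 < c := by positivity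
  set f := circleChirp N x
  have hcoef : ∀ t, t < y → ENNReal.ofReal c ≤ rearr Measure.count (fourierCoeff f) t := by
    intro t ht
    refine le_rearr (((ENNReal.ofReal_lt_ofReal_iff hy0).2 ht).trans_le
      ((le_count_abs_le hy0.le).trans (measure_mono fun n hn => ?_)))
    have hn : |(n : ℝ)| ≤ y := hn
    have hnx : |(n : ℝ)| * (x / N) ≤ 1 / 6 := by
      calc |(n : ℝ)| * (x / N) ≤ y * (x / N) := by gcongr
        _ = (x * y) / N := by ring
        _ ≤ 1 / 6 := by rw [div_le_iff₀ hN0]; linarith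
    change ENNReal.ofReal c ≤ ‖fourierCoeff f n‖ₑ
    rw [← ofReal_norm]
    exact ENNReal.ofReal_le_ofReal (le_norm_fourierCoeff_circleChirp N hNodd hx hx1 hnx)
  set U := ∫⁻ t in Ioo 0 y, u t
  have h1 : ENNReal.ofReal c * U ^ (1 / q) ≤ C * cutoffNorm p w x := by
    calc ENNReal.ofReal c * U ^ (1 / q)
        = (∫⁻ t in Ioo 0 y, ENNReal.ofReal c ^ q * u t) ^ (1 / q) := by
          rw [lintegral_const_mul' _ _ (ENNReal.rpow_ne_top_of_nonneg hq.le (by simp)),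
            ENNReal.mul_rpow_of_nonneg _ _ (by positivity), ← ENNReal.rpow_mul,
            mul_one_div_cancel hq.ne', ENNReal.rpow_one]
      _ ≤ lambdaNorm q u Measure.count (fourierCoeff f) := by
          refine ENNReal.rpow_le_rpow ?_ (by positivity)
          rw [lintegral_Ioo_eq_halfLine]
          refine le_trans (setLIntegral_mono' measurableSet_Iio fun t ht => ?_)
            (setLIntegral_le_lintegral (Iio y) _)
          gcongr
          exact hcoef t ht
      _ ≤ C * gammaNorm p w AddCircle.haarAddCircle f := hC f (integrable_circleChirp N x)
      _ ≤ C * cutoffNorm p w x := by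
          gcongr
          refine gammaNorm_le_cutoffNorm (fun y => ?_) (haar_support_circleChirp_le N) hp.le w
          rw [← ofReal_norm, ← ENNReal.ofReal_one]
          exact ENNReal.ofReal_le_ofReal (norm_circleChirp_le N x y)
  have hmin : min (ENNReal.ofReal x) (ENNReal.ofReal a)⁻¹ = ENNReal.ofReal y⁻¹ := by
    rw [← ENNReal.ofReal_inv_of_pos ha, ← ENNReal.ofReal_min]
    congr 1
    rcases le_total a x⁻¹ with h | h
    · rw [hy, max_eq_right h, inv_inv, min_eq_left ((le_inv_comm₀ ha hx).1 h)]
    · rw [hy, max_eq_left h, min_eq_right ((inv_le_comm₀ hx ha).1 h)]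
  calc ENNReal.ofReal x * (min (ENNReal.ofReal x) (ENNReal.ofReal a)⁻¹ *
        (∫⁻ t in Ioo 0 a, u t) ^ (1 / (q / 2)))
      ≤ ENNReal.ofReal x * (ENNReal.ofReal y⁻¹ * U ^ (1 / (q / 2))) := by
        rw [hmin]
        gcongr
        exact lintegral_Ioo_mono u (le_max_left _ _)
    _ = ENNReal.ofReal (x * y⁻¹) * (U ^ (1 / q)) ^ 2 := by
        rw [← ENNReal.rpow_two, ← ENNReal.rpow_mul, ENNReal.ofReal_mul hx.le, mul_assoc]
        congr 3
        field_simp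
    _ ≤ (36 * ENNReal.ofReal c ^ 2) * (U ^ (1 / q)) ^ 2 := by
        gcongr
        rw [← ENNReal.ofReal_pow hc0.le, ← ENNReal.ofReal_ofNat 36,
          ← ENNReal.ofReal_mul (by norm_num)]
        refine ENNReal.ofReal_le_ofReal ?_
        rw [hc, div_pow, mul_pow, Real.sq_sqrt hN0.le, ← div_eq_mul_inv, ← mul_div_assoc,
          div_le_div_iff₀ hy0 (by positivity)]
        have := mul_le_mul_of_nonneg_left hN2 hx.le
        change x * (2 ^ 2 * (N : ℝ)) ≤ (36 : ℝ) * x ^ 2 * y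
        linarith
    _ = 36 * (ENNReal.ofReal c * U ^ (1 / q)) ^ 2 := by ring
    _ ≤ 36 * (C * cutoffNorm p w x) ^ 2 := by gcongr
    _ = _ := by ring

theorem COmega_le {p q : ℝ} (hp : 0 < p) {u w : ℝ → ℝ≥0∞} {D : ℝ≥0∞}
    (h : ∀ x, 0 < x → x < 1 →
      thetaNorm (q / 2) u halfLine (omega x⁻¹) ≤ D * cutoffNorm p w x ^ 2) :
    COmega p q u w ≤ D := by
  refine iSup₂_le fun z hz => ENNReal.div_le_of_le_mul ?_
  have hz0 : 0 < z := by linarith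
  have h1 := h z⁻¹ (inv_pos.2 hz0) (inv_lt_one_of_one_lt₀ hz)
  rwa [← weightedNorm_omega hp w (inv_pos.2 hz0), inv_inv] at h1

/-- A bound `x θ(x) ≤ D ‖min(1, x/·)‖²_{p,w}` for `0 < x < 1` makes `C_ω` finite. -/
theorem COmega_lt_top_of_hull_le {p q : ℝ} (hp : 0 < p) (hq : 2 ≤ q) {u w : ℝ → ℝ≥0∞}
    (hu : AEMeasurable u halfLine) {D : ℝ≥0∞} (hD : D ≠ ∞)
    (h : ∀ x, 0 < x → x < 1 → ENNReal.ofReal x * hull (q / 2) u x ≤ D * cutoffNorm p w x ^ 2) :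
    COmega p q u w < ∞ := by
  refine lt_of_le_of_lt (COmega_le (D := 3 * D) hp fun x hx hx1 => ?_)
    (ENNReal.mul_lt_top (by simp) (lt_top_iff_ne_top.2 hD))
  refine (thetaNorm_le_hull (by linarith) hu hx).trans ?_
  rw [mul_assoc]
  exact mul_le_mul' le_rfl (h x hx hx1)

/-! ### The case `q = 2` -/

theorem cutoffNorm_eq {p : ℝ} (hp : 0 < p) (w : ℝ → ℝ≥0∞) {x : ℝ} (hx : 0 < x) :
    cutoffNorm p w x = ENNReal.ofReal x *
      (ENNReal.ofReal (x ^ (-p)) * (∫⁻ t in Ioo 0 x, w t) +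
        ∫⁻ t in Ioi x, w t * ENNReal.ofReal (t ^ (-p))) ^ (1 / p) := by
  have hxp : ENNReal.ofReal x ^ p ≠ ∞ := ENNReal.rpow_ne_top_of_nonneg hp.le (by simp)
  have hE : ∫⁻ s, ENNReal.ofReal (min 1 (x / s)) ^ p * w s ∂halfLine =
      ENNReal.ofReal x ^ p * (ENNReal.ofReal (x ^ (-p)) * (∫⁻ t in Ioo 0 x, w t) +
        ∫⁻ t in Ioi x, w t * ENNReal.ofReal (t ^ (-p))) := by
    have hsplit : (Ioi 0 : Set ℝ) = Ioc 0 x ∪ Ioi x := (Ioc_union_Ioi_eq_Ioi hx.le).symm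
    rw [halfLine, hsplit, lintegral_union measurableSet_Ioi
      (disjoint_left.2 fun t ht ht' => absurd ht.2 (not_le.2 ht')), mul_add, ← mul_assoc,
      ENNReal.ofReal_rpow_of_pos hx, ← ENNReal.ofReal_mul (by positivity), ← Real.rpow_add hx,
      add_neg_cancel, Real.rpow_zero, ENNReal.ofReal_one, one_mul,
      ← lintegral_const_mul' _ _ (by simp), Measure.restrict_congr_set Ioo_ae_eq_Ioc]
    congr 1
    · refine setLIntegral_congr_fun measurableSet_Ioc fun t ht => ?_
      rw [min_eq_left ((one_le_div ht.1).2 ht.2), ENNReal.ofReal_one, ENNReal.one_rpow, one_mul]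
    · refine setLIntegral_congr_fun measurableSet_Ioi fun t ht => ?_
      have ht0 : 0 < t := hx.trans ht
      rw [min_eq_right ((div_le_one ht0).2 (le_of_lt ht)), ENNReal.ofReal_rpow_of_pos (by positivity),
        Real.div_rpow hx.le ht0.le, div_eq_mul_inv, ← Real.rpow_neg ht0.le,
        ENNReal.ofReal_mul (by positivity)]
      ring
  rw [cutoffNorm, weightedNorm, hE, ENNReal.mul_rpow_of_nonneg _ _ (by positivity),
    ← ENNReal.rpow_mul, mul_one_div_cancel hp.ne', ENNReal.rpow_one]

/-- The squares of the quotients that define `C_xy`. -/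
theorem Cxy_term_sq {p : ℝ} (hp : 0 < p) (u w : ℝ → ℝ≥0∞) {x y : ℝ} (hx : 0 < x) (hy : 0 < y) :
    ((ENNReal.ofReal (1 / (x * y)) * ∫⁻ t in Ioo 0 y, u t) ^ (1 / 2 : ℝ) *
      (ENNReal.ofReal (x ^ (-p)) * (∫⁻ t in Ioo 0 x, w t) +
        ∫⁻ t in Ioi x, w t * ENNReal.ofReal (t ^ (-p))) ^ (-(1 / p))) ^ 2 =
    (ENNReal.ofReal (x / y) * ∫⁻ t in Ioo 0 y, u t) / cutoffNorm p w x ^ 2 := by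
  rw [cutoffNorm_eq hp w hx]
  set E := ENNReal.ofReal (x ^ (-p)) * (∫⁻ t in Ioo 0 x, w t) +
        ∫⁻ t in Ioi x, w t * ENNReal.ofReal (t ^ (-p))
  set U := ∫⁻ t in Ioo 0 y, u t
  have h1 : ((ENNReal.ofReal (1 / (x * y)) * U) ^ (1 / 2 : ℝ)) ^ 2 =
      ENNReal.ofReal (1 / (x * y)) * U := by
    rw [← ENNReal.rpow_two, ← ENNReal.rpow_mul]; norm_num
  have hx2 : ENNReal.ofReal (x / y) = ENNReal.ofReal (1 / (x * y)) * ENNReal.ofReal x ^ 2 := by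
    rw [← ENNReal.ofReal_pow hx.le, ← ENNReal.ofReal_mul (by positivity)]
    congr 1
    field_simp
  have hxne : ENNReal.ofReal x ^ 2 ≠ 0 := by simpa using hx
  rw [mul_pow, h1, ENNReal.rpow_neg, mul_pow, hx2, ENNReal.div_eq_inv_mul,
    ENNReal.mul_inv (Or.inl hxne) (Or.inl (by simp)), ENNReal.inv_pow (a := E ^ (1 / p))]
  calc ENNReal.ofReal (1 / (x * y)) * U * (E ^ (1 / p))⁻¹ ^ 2
      = ENNReal.ofReal (1 / (x * y)) * (ENNReal.ofReal x ^ 2 * (ENNReal.ofReal x ^ 2)⁻¹) * U *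
          (E ^ (1 / p))⁻¹ ^ 2 := by
        rw [ENNReal.mul_inv_cancel hxne (by simp), mul_one]
    _ = _ := by ring

/-- For `q = 2` the terms of `x θ(x)` are, up to a factor `2`, the numbers `(x/y) ∫_0^y u` with `y > 1/x`. -/
theorem COmega_two_lt_top_iff {p : ℝ} (hp : 0 < p) {u w : ℝ → ℝ≥0∞}
    (hu : AEMeasurable u halfLine) : COmega p 2 u w < ∞ ↔ Cxy p u w < ∞ := by
  constructor
  · intro h
    refine lt_of_le_of_lt (b := (COmega p 2 u w + 1) ^ (1 / 2 : ℝ)) ?_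
      (ENNReal.rpow_lt_top_of_nonneg (by norm_num) (by simp [h.ne]))
    refine iSup₂_le fun x y => iSup_le fun hx => iSup₂_le fun hx1 hxy => ?_
    have hx1 : x < 1 := by rwa [one_lt_div hx] at hx1
    have hy : 0 < y := lt_trans (by positivity) hxy
    rw [← ENNReal.pow_le_pow_left_iff two_ne_zero, Cxy_term_sq hp u w hx hy]
    refine ENNReal.div_le_of_le_mul ?_
    rw [← ENNReal.rpow_two ((COmega p 2 u w + 1) ^ (1 / 2 : ℝ)), ← ENNReal.rpow_mul]
    norm_num
    refine le_trans ?_ (thetaNorm_le_of_COmega_lt_top hp h hx hx1)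
    refine le_trans ?_ (hull_le_thetaNorm (by norm_num) hx)
    rw [div_eq_mul_inv, ENNReal.ofReal_mul hx.le, mul_assoc]
    gcongr
    refine le_trans ?_ (le_iSup₂_of_le y hy le_rfl)
    rw [ENNReal.ofReal_inv_of_pos hy, min_eq_right]
    · norm_num
    · rw [← ENNReal.ofReal_inv_of_pos hy]
      refine ENNReal.ofReal_le_ofReal ?_
      rw [one_div] at hxy
      exact ((inv_lt_comm₀ hx hy).1 hxy).le
  · intro h
    set D := Cxy p u w ^ 2 + 1 with hD
    have hDfin : D ≠ ∞ := by simp [hD, h.ne]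
    refine COmega_lt_top_of_hull_le hp le_rfl hu (D := 2 * D)
      (ENNReal.mul_ne_top (by simp) hDfin) fun x hx hx1 => ?_
    rw [hull, ENNReal.mul_iSup]
    refine iSup_le fun a => ?_
    rw [ENNReal.mul_iSup]
    refine iSup_le fun ha => ?_
    -- The factor `2` makes the inequality `1/x < y` strict.
    set y := 2 * max a x⁻¹ with hy
    have hx' : 0 < x⁻¹ := inv_pos.2 hx
    have hmax : 0 < max a x⁻¹ := lt_of_lt_of_le ha (le_max_left _ _)
    have hy0 : 0 < y := by positivity
    have hxy : 1 / x < y := by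
      rw [one_div]; have := le_max_right a x⁻¹; linarith
    have hay : a ≤ y := by have := le_max_left a x⁻¹; linarith
    set U := ∫⁻ t in Ioo 0 y, u t
    have hterm : ENNReal.ofReal (x / y) * U ≤ D * cutoffNorm p w x ^ 2 := by
      have h1 : (ENNReal.ofReal (x / y) * U) / cutoffNorm p w x ^ 2 ≤ D := by
        rw [← Cxy_term_sq hp u w hx hy0]
        refine le_trans ?_ (le_self_add (a := Cxy p u w ^ 2) (b := 1))
        refine pow_le_pow_left' ?_ 2
        exact le_iSup₂_of_le x y (le_iSup_of_le hx
          (le_iSup₂_of_le ((one_lt_div hx).2 hx1) hxy le_rfl))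
      rwa [ENNReal.div_le_iff_le_mul (Or.inr hDfin) (Or.inr (by simp [hD]))] at h1
    have hmin : min (ENNReal.ofReal x) (ENNReal.ofReal a)⁻¹ ≤ 2 * ENNReal.ofReal y⁻¹ := by
      rw [← ENNReal.ofReal_inv_of_pos ha, ← ENNReal.ofReal_min, ← ENNReal.ofReal_ofNat 2,
        ← ENNReal.ofReal_mul (by norm_num)]
      refine ENNReal.ofReal_le_ofReal ?_
      rw [hy, mul_inv, mul_inv_cancel_left₀ two_ne_zero]
      rcases le_total a x⁻¹ with h | h
      · rw [max_eq_right h, inv_inv]; exact min_le_left _ _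
      · rw [max_eq_left h]; exact min_le_right _ _
    calc ENNReal.ofReal x * (min (ENNReal.ofReal x) (ENNReal.ofReal a)⁻¹ *
          (∫⁻ t in Ioo 0 a, u t) ^ (1 / (2 / 2 : ℝ)))
        ≤ ENNReal.ofReal x * (2 * ENNReal.ofReal y⁻¹ * U) := by
          rw [div_self two_ne_zero, div_one, ENNReal.rpow_one]
          gcongr
          exact lintegral_Ioo_mono u hay
      _ = 2 * (ENNReal.ofReal (x / y) * U) := by
          rw [div_eq_mul_inv, ENNReal.ofReal_mul hx.le]; ring
      _ ≤ 2 * (D * cutoffNorm p w x ^ 2) := by gcongr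
      _ = _ := by ring

/-! ### The Fourier coefficient operator -/

theorem rearr_congr_ae {X E : Type*} [MeasurableSpace X] [NormedAddCommGroup E] {μ : Measure X}
    {f g : X → E} (h : f =ᵐ[μ] g) : rearr μ f = rearr μ g := by
  funext t
  unfold rearr
  congr 1
  ext l
  have : μ {x | l < ‖f x‖ₑ} = μ {x | l < ‖g x‖ₑ} := by
    refine measure_congr ?_
    filter_upwards [h] with x hx
    exact congrArg (fun a => l < ‖a‖ₑ) hx
  simp only [mem_ofPred_eq, this]

theorem rearr_map_equiv {X X' E : Type*} [MeasurableSpace X] [MeasurableSpace X']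
    [NormedAddCommGroup E] (μ : Measure X) (e : X ≃ᵐ X') (f : X' → E) :
    rearr (μ.map e) f = rearr μ (f ∘ e) := by
  funext t
  unfold rearr
  simp_rw [e.map_apply]
  rfl

theorem gammaNorm_congr_rearr {X X' E E' : Type*} [MeasurableSpace X] [MeasurableSpace X']
    [NormedAddCommGroup E] [NormedAddCommGroup E'] {μ : Measure X} {μ' : Measure X'} {f : X → E}
    {g : X' → E'} (h : rearr μ f = rearr μ' g) (p : ℝ) (w : ℝ → ℝ≥0∞) :
    gammaNorm p w μ f = gammaNorm p w μ' g := by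
  unfold gammaNorm rearrAvg
  rw [h]

theorem enorm_fourierCoeff_le (f : UnitAddCircle → ℂ) (n : ℤ) :
    ‖fourierCoeff f n‖ₑ ≤ eLpNorm f 1 AddCircle.haarAddCircle := by
  rw [eLpNorm_one_eq_lintegral_enorm]
  refine (enorm_integral_le_lintegral_enorm _).trans (le_of_eq (lintegral_congr fun x => ?_))
  rw [smul_eq_mul, enorm_mul, fourier_apply, ← ofReal_norm, Circle.norm_coe, ENNReal.ofReal_one,
    one_mul]

/-- **Parseval's identity** in terms of lower integrals. -/
theorem lintegral_sq_fourierCoeff {f : UnitAddCircle → ℂ}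
    (hf : MemLp f 2 AddCircle.haarAddCircle) :
    ∫⁻ n, ‖fourierCoeff f n‖ₑ ^ 2 ∂Measure.count =
      ∫⁻ x, ‖f x‖ₑ ^ 2 ∂AddCircle.haarAddCircle := by
  have hsum := hasSum_sq_fourierCoeff (hf.toLp f)
  rw [fourierCoeff_congr_ae hf.coeFn_toLp] at hsum
  have hae : ∫ t, ‖hf.toLp f t‖ ^ 2 ∂AddCircle.haarAddCircle =
      ∫ t, ‖f t‖ ^ 2 ∂AddCircle.haarAddCircle :=
    integral_congr_ae (hf.coeFn_toLp.mono fun x hx => by simp only [hx])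
  rw [hae] at hsum
  have hint : Integrable (fun x => ‖f x‖ ^ 2) AddCircle.haarAddCircle := by
    simpa using hf.integrable_norm_pow two_ne_zero
  have h2 : ∀ z : ℂ, ‖z‖ₑ ^ 2 = ENNReal.ofReal (‖z‖ ^ 2) := fun z => by
    rw [ENNReal.ofReal_pow (norm_nonneg _), ofReal_norm]
  simp_rw [h2]
  rw [lintegral_count, ← ofReal_integral_eq_lintegral_ofReal hint (ae_of_all _ fun x => by positivity),
    ← hsum.tsum_eq, ENNReal.ofReal_tsum_of_nonneg (fun n => by positivity) hsum.summable]

universe v₁ v₂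

/-- Normalized Haar measure on a copy of the circle in a given universe. The universe of the measure
spaces in the theorem is arbitrary. -/
def liftedHaar : Measure (ULift.{v₁} UnitAddCircle) :=
  (AddCircle.haarAddCircle : Measure UnitAddCircle).map MeasurableEquiv.ulift.symm

/-- Counting measure on a copy of the integers in a given universe. -/
def liftedCount : Measure (ULift.{v₂} ℤ) :=
  (Measure.count : Measure ℤ).map MeasurableEquiv.ulift.symm

instance : IsProbabilityMeasure liftedHaar.{v₁} :=
  Measure.isProbabilityMeasure_map MeasurableEquiv.ulift.symm.measurable.aemeasurable

instance : SigmaFinite liftedCount.{v₂} := MeasurableEquiv.sigmaFinite_map _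

theorem measurePreserving_liftedHaar : MeasurePreserving
    (MeasurableEquiv.ulift.symm : UnitAddCircle ≃ᵐ ULift.{v₁} UnitAddCircle)
    AddCircle.haarAddCircle liftedHaar := ⟨MeasurableEquiv.measurable _, rfl⟩

/-- The Fourier coefficient map between copies of the circle and the integers in given universes. -/
def fourierOperator (g : Lp ℂ 1 liftedHaar.{v₁}) : ULift.{v₂} ℤ →ₘ[liftedCount] ℂ :=
  AEEqFun.mk (fun n => fourierCoeff (fun c : UnitAddCircle => g (ULift.up c)) n.down)
    ((measurable_of_countable (fourierCoeff fun c : UnitAddCircle => g (ULift.up c))).comp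
      MeasurableEquiv.ulift.measurable).aestronglyMeasurable

theorem coeFn_fourierOperator (g : Lp ℂ 1 liftedHaar.{v₁}) :
    fourierOperator.{v₁, v₂} g =ᵐ[liftedCount]
      fun n => fourierCoeff (fun c : UnitAddCircle => g (ULift.up c)) n.down :=
  AEEqFun.coeFn_mk _ _

theorem ae_comp_up {g h : ULift.{v₁} UnitAddCircle → ℂ} (hgh : g =ᵐ[liftedHaar] h) :
    (fun c => g (ULift.up c)) =ᵐ[AddCircle.haarAddCircle] fun c => h (ULift.up c) :=
  measurePreserving_liftedHaar.quasiMeasurePreserving.ae_eq_comp hgh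

theorem eLpNorm_comp_up (g : Lp ℂ 1 liftedHaar.{v₁}) (r : ℝ≥0∞) :
    eLpNorm (fun c : UnitAddCircle => g (ULift.up c)) r AddCircle.haarAddCircle =
      eLpNorm g r liftedHaar :=
  eLpNorm_comp_measurePreserving (Lp.aestronglyMeasurable g) measurePreserving_liftedHaar

theorem integrable_comp_up (g : Lp ℂ 1 liftedHaar.{v₁}) :
    Integrable (fun c : UnitAddCircle => g (ULift.up c)) AddCircle.haarAddCircle :=
  memLp_one_iff_integrable.1 ((Lp.memLp g).comp_measurePreserving measurePreserving_liftedHaar)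

theorem isSublinearOfType_fourierOperator :
    IsSublinearOfType liftedHaar.{v₁} liftedCount fourierOperator.{v₁, v₂} where
  add_le f g := by
    have h := fourierCoeff_congr_ae (ae_comp_up (Lp.coeFn_add f g))
    filter_upwards [coeFn_fourierOperator.{v₁, v₂} (f + g), coeFn_fourierOperator.{v₁, v₂} f,
      coeFn_fourierOperator.{v₁, v₂} g] with n h1 h2 h3
    rw [h1, h2, h3, h]
    have := fourierCoeff.add (integrable_comp_up f) (integrable_comp_up g)
    refine le_trans (le_of_eq ?_) (norm_add_le _ _)
    exact congrArg norm (congrFun this n.down)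
  smul_eq c f := by
    have h := fourierCoeff_congr_ae (ae_comp_up (Lp.coeFn_smul c f))
    filter_upwards [coeFn_fourierOperator.{v₁, v₂} (c • f), coeFn_fourierOperator.{v₁, v₂} f]
      with n h1 h2
    rw [h1, h2, h, ← norm_smul]
    exact congrArg norm
      (fourierCoeff.const_smul (fun x : UnitAddCircle => f (ULift.up x)) c n.down)
  bound_one := by
    refine ⟨1, fun f => ?_⟩
    rw [eLpNorm_exponent_top, ENNReal.coe_one, one_mul]
    refine eLpNormEssSup_le_of_ae_enorm_bound ?_
    filter_upwards [coeFn_fourierOperator.{v₁, v₂} f] with n hn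
    rw [hn, ← eLpNorm_comp_up]
    exact enorm_fourierCoeff_le _ _
  bound_two := by
    refine ⟨1, fun f hf => ?_⟩
    have hf' : MemLp (fun c : UnitAddCircle => f (ULift.up c)) 2 AddCircle.haarAddCircle :=
      hf.comp_measurePreserving measurePreserving_liftedHaar
    rw [ENNReal.coe_one, one_mul, ← ENNReal.pow_le_pow_left_iff two_ne_zero, sq_eLpNorm_two,
      ← eLpNorm_comp_up, sq_eLpNorm_two, ← lintegral_sq_fourierCoeff hf',
      lintegral_congr_ae ((coeFn_fourierOperator.{v₁, v₂} f).mono fun n hn => by rw [hn]),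
      liftedCount, lintegral_map_equiv]
    exact le_rfl

/-- The inequality for the operator on the lifted spaces is the inequality on the circle, as norms only
depend on rearrangements. -/
theorem fourier_gammaNorm_of_operator {p q : ℝ} {u w : ℝ → ℝ≥0∞} {C : ℝ≥0}
    (hC : ∀ f, gammaNorm q u liftedCount.{v₂} (fourierOperator.{v₁, v₂} f) ≤
      C * gammaNorm p w liftedHaar.{v₁} f)
    {f : UnitAddCircle → ℂ} (hf : Integrable f AddCircle.haarAddCircle) :
    gammaNorm q u Measure.count (fourierCoeff f) ≤
      C * gammaNorm p w AddCircle.haarAddCircle f := by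
  have hF : MemLp (fun c : ULift.{v₁} UnitAddCircle => f c.down) 1 liftedHaar := by
    rw [memLp_one_iff_integrable, liftedHaar, integrable_map_equiv]
    exact hf
  set F := hF.toLp
  have h1 : rearr liftedHaar F = rearr AddCircle.haarAddCircle f := by
    rw [rearr_congr_ae hF.coeFn_toLp, liftedHaar, rearr_map_equiv]
    rfl
  have h2 : rearr liftedCount (fourierOperator.{v₁, v₂} F) =
      rearr Measure.count (fourierCoeff f) := by
    rw [rearr_congr_ae (coeFn_fourierOperator F), fourierCoeff_congr_ae (ae_comp_up hF.coeFn_toLp),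
      liftedCount, rearr_map_equiv]
    rfl
  rw [← gammaNorm_congr_rearr h1, ← gammaNorm_congr_rearr h2]
  exact hC F

end LorentzFourier

end

open LorentzFourier in
theorem theorem4p7 (p q : ℝ) (hp : 0 < p) (hp2 : p ≤ 2) (hq : 2 ≤ q)
    (u w : ℝ → ℝ≥0∞) (hu : AEMeasurable u halfLine) (hw : AEMeasurable w halfLine) :
    List.TFAE
      [ ∀ (X : Type*) (Y : Type*) [MeasurableSpace X] [MeasurableSpace Y]
          (μ : Measure X) (ν : Measure Y) [IsProbabilityMeasure μ] [SigmaFinite ν]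
          (T : Lp ℂ 1 μ → (Y →ₘ[ν] ℂ)), IsSublinearOfType μ ν T →
            ∃ C : ℝ≥0, ∀ f : Lp ℂ 1 μ, gammaNorm q u ν (T f) ≤ C * gammaNorm p w μ f,
        ∃ C : ℝ≥0, ∀ f : UnitAddCircle → ℂ, Integrable f AddCircle.haarAddCircle →
          gammaNorm q u Measure.count (fourierCoeff f) ≤
            C * gammaNorm p w AddCircle.haarAddCircle f,
        ∃ C : ℝ≥0, ∀ f : UnitAddCircle → ℂ, Integrable f AddCircle.haarAddCircle →
          lambdaNorm q u Measure.count (fourierCoeff f) ≤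
            C * gammaNorm p w AddCircle.haarAddCircle f,
        COmega p q u w < ∞ ] ∧
    (q = 2 → (COmega p q u w < ∞ ↔ Cxy p u w < ∞)) := by
  have hq0 : 0 < q := by linarith
  refine ⟨?_, ?_⟩
  · tfae_have 1 → 2 := by
      intro h
      obtain ⟨C, hC⟩ := h _ _ liftedHaar liftedCount fourierOperator
        isSublinearOfType_fourierOperator
      exact ⟨C, fun f hf => fourier_gammaNorm_of_operator hC hf⟩
    tfae_have 2 → 3 := by
      rintro ⟨C, hC⟩
      exact ⟨C, fun f hf => (lambdaNorm_le_gammaNorm hq0.le u _ _).trans (hC f hf)⟩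
    tfae_have 3 → 4 := by
      rintro ⟨C, hC⟩
      exact COmega_lt_top_of_hull_le hp hq hu
        (ENNReal.mul_ne_top (by simp) (by simp) : (36 * (C : ℝ≥0∞) ^ 2) ≠ ∞)
        fun x hx hx1 => hull_le_of_fourier_bound hp hq0 hC hx hx1
    tfae_have 4 → 1 := by
      intro h X Y _ _ μ ν _ _ T hT
      exact hT.exists_gammaNorm_le hp hp2 hq hu hw h
    tfae_finish
  · rintro rfl
    exact COmega_two_lt_top_iff hp hu
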